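/- Let $m\ge 2$ be an integer and $\Sigma=\{\alpha_1,\dots,\alpha_m,\beta_1,\dots,\beta_m\}$. Let $M$ be the Dyck monoid: the monoid with zero generated by $\Sigma$ subject to $\alpha_j\beta_j=1$ for all $j$ and $\alpha_i\beta_j=0$ for $i\neq j$. The Dyck shift $X\subset\Sigma^{\mathbb Z}$ is the set of all $x$ such that every finite block $x_r x_{r+1}\cdots x_l$ is nonzero in $M$, with the left shift $T$, $(Tx)_n=x_{n+1}$. For $z\in\{0,1\}^{\mathbb Z}$ let $\tilde H_0(z)=0$ and $\tilde H_{i+1}(z)-\tilde H_i(z)=1$ if $z_i=1$ and $-1$ if $z_i=0$, for all $i\in\mathbb Z$. Let $S$ be the set of all $z$ with $\liminf_{i\to+\infty}\tilde H_i(z)=\liminf_{i\to-\infty}\tilde H_i(z)=-\infty$. Put $\gamma_k(z)=\sum_{i=0}^{k}z_i$ for $k\ge 0$, $\gamma_k(z)=-\sum_{i=k}^{-1}z_i$ for $k<0$, and, for $z\in S$, $\varepsilon_n(z)=\max\{l<n:\tilde H_l(z)\le\tilde H_{n+1}(z)\}$. Define $F:S\times\{1,\dots,m\}^{\mathbb Z}\to\Sigma^{\mathbb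 Z}$ by $F(z,a)_n=\alpha_j$ with $j=a_{\gamma_n(z)}$ if $z_n=1$, and $F(z,a)_n=\beta_j$ with $j=a_{\gamma_k(z)}$, $k=\varepsilon_n(z)$, if $z_n=0$. Let $\mu_1,\mu_2$ be the symmetric (uniform) product measures on $\{0,1\}^{\mathbb Z}$ and $\{1,\dots,m\}^{\mathbb Z}$, and let $\tilde\mu=(\mu_1\times\mu_2)\circ F^{-1}$, regarded as a Borel measure on $X$. A Borel measure $\mu$ on $X$ is double-tail invariant if $\mu(A)=\mu(g(A))$ for every Borel set $A\subset X$ and every injective Borel map $g:A\to X$ such that, for every $x\in A$, $x$ and $g(x)$ differ in only finitely many coordinates. A measure of maximal entropy is a $T$-invariant Borel probability whose Kolmogorov–Sinai entropy equals the topological entropy $h_{\mathrm{top}}(X,T)$. Then $\tilde\mu$ is a probability measure on $X$ that is both $T$-invariant and double-tail invariant, and its Kolmogorov–Sinai entropy (with natural logarithms) is $$h_{\tilde\mu}(X,T)=\log 2+\tfrac12\log m .$$ Moreover $h_{\tilde\mu}(X,T)<h_{\mathrm{top}}(X,T)$; in particular $\tilde\mu$ is not a measure of maximal entropy. -/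

import Mathlib

open MeasureTheory Filter

/-! ### Entropy of a measure and double-tail invariance -/

section General

variable {Ω : Type*} [MeasurableSpace Ω]

/-- Shannon entropy (natural logarithm) of the partition of `Ω` into the fibres of `P`. -/
noncomputable def partitionEntropy {ι : Type*} [Fintype ι] (μ : Measure Ω) (P : Ω → ι) : ℝ :=
  ∑ i, Real.negMulLog (μ.real (P ⁻¹' {i}))

/-- The join of the partitions `P, T⁻¹ P, …, T⁻⁽ⁿ⁻¹⁾ P`, labelled by itineraries of length `n`. -/
def itinerary {ι : Type*} (T : Ω → Ω) (P : Ω → ι) (n : ℕ) (x : Ω) : Fin n → ι :=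
  fun j => P (T^[j] x)

/-- Entropy of `T` relative to the finite partition `P`: the (upper) limit of
`H_μ(P ∨ T⁻¹ P ∨ … ∨ T⁻⁽ⁿ⁻¹⁾ P) / n`. -/
noncomputable def entropyOfPartition {ι : Type*} [Fintype ι] (μ : Measure Ω) (T : Ω → Ω)
    (P : Ω → ι) : EReal :=
  limsup (fun n : ℕ => ((partitionEntropy μ (itinerary T P n) / n : ℝ) : EReal)) atTop

/-- Kolmogorov–Sinai entropy: the supremum over all finite measurable partitions, a partition into
at most `k` pieces being given by a measurable map to `Fin k`. -/
noncomputable def ksEntropy (μ : Measure Ω) (T : Ω → Ω) : EReal :=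
  ⨆ (k : ℕ) (P : Ω → Fin k) (_ : Measurable P), entropyOfPartition μ T P

/-- A measure of maximal entropy: an invariant probability whose entropy equals the topological
entropy. -/
def IsMaximalEntropyMeasure [UniformSpace Ω] (μ : Measure Ω) (T : Ω → Ω) : Prop :=
  IsProbabilityMeasure μ ∧ MeasurePreserving T μ μ ∧
    ksEntropy μ T = Dynamics.coverEntropy T Set.univ

/-- The double-tail (homoclinic) relation of a subset `X` of a full two-sided shift. -/
def DoubleTail {A : Type*} {X : Set (ℤ → A)} (x y : X) : Prop :=
  ∃ n : ℕ, ∀ k : ℤ, (n : ℤ) < |k| → x.1 k = y.1 k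

/-- `g`, regarded as a map on `S`, is a holonomy of the double-tail relation. -/
structure IsHolonomy {A : Type*} [MeasurableSpace A] {X : Set (ℤ → A)} (S : Set X) (g : S → X) :
    Prop where
  measurableSet_domain : MeasurableSet S
  measurable : Measurable g
  injective : Function.Injective g
  doubleTail : ∀ x : S, DoubleTail x.1 (g x)

def DoubleTailInvariant {A : Type*} [MeasurableSpace A] {X : Set (ℤ → A)} (μ : Measure X) : Prop :=
  ∀ (S : Set X) (g : S → X), IsHolonomy S g → μ S = μ (Set.range g)

end General

/-! ### The Dyck shift -/

/-- The alphabet `α₁, …, αₘ, β₁, …, βₘ`. -/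
inductive DyckLetter (m : ℕ) : Type
  | α (j : Fin m)
  | β (j : Fin m)

instance (m : ℕ) : MeasurableSpace (DyckLetter m) := ⊤

/-- The discrete uniform structure. -/
instance (m : ℕ) : UniformSpace (DyckLetter m) := ⊥

/-- The defining relations of the Dyck monoid, on the free monoid with a zero adjoined. -/
inductive DyckRel (m : ℕ) :
    WithZero (FreeMonoid (DyckLetter m)) → WithZero (FreeMonoid (DyckLetter m)) → Prop
  | cancel (j : Fin m) : DyckRel m
      ((FreeMonoid.of (DyckLetter.α j) * FreeMonoid.of (DyckLetter.β j) :
        FreeMonoid (DyckLetter m)) : WithZero (FreeMonoid (DyckLetter m))) 1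
  | mismatch (i j : Fin m) (h : i ≠ j) : DyckRel m
      ((FreeMonoid.of (DyckLetter.α i) * FreeMonoid.of (DyckLetter.β j) :
        FreeMonoid (DyckLetter m)) : WithZero (FreeMonoid (DyckLetter m))) 0

/-- Equality in the Dyck monoid: the congruence generated by the defining relations. -/
def dyckCon (m : ℕ) : Con (WithZero (FreeMonoid (DyckLetter m))) := conGen (DyckRel m)

/-- The Dyck language: the words that are nonzero in the Dyck monoid. -/
def dyckLanguage (m : ℕ) : Set (FreeMonoid (DyckLetter m)) :=
  {w | ¬ dyckCon m (w : WithZero (FreeMonoid (DyckLetter m))) 0}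

/-- The word `x_r x_{r+1} … x_{r+n-1}`. -/
def block {A : Type*} (x : ℤ → A) (r : ℤ) (n : ℕ) : FreeMonoid A :=
  FreeMonoid.ofList ((List.range n).map fun i => x (r + i))

/-- The two-sided Dyck shift. -/
def dyckShift (m : ℕ) : Set (ℤ → DyckLetter m) :=
  {x | ∀ (r : ℤ) (n : ℕ), block x r n ∈ dyckLanguage m}

theorem shift_mem_dyckShift {m : ℕ} {x : ℤ → DyckLetter m} (hx : x ∈ dyckShift m) :
    (fun n => x (n + 1)) ∈ dyckShift m := by
  intro r n
  have h := hx (r + 1) n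
  have e : block (fun n => x (n + 1)) r n = block x (r + 1) n := by
    unfold block
    refine congrArg _ (List.map_congr_left fun i _ => congrArg x ?_)
    ring
  rw [e]
  exact h

/-- The left shift on the Dyck shift. -/
def dyckT (m : ℕ) (x : dyckShift m) : dyckShift m :=
  ⟨fun n => x.1 (n + 1), shift_mem_dyckShift x.2⟩

/-! ### The measure

Elements of `{0,1}^ℤ` are maps `z : ℤ → Bool`, with `true` for `1`. -/

/-- The height cocycle; `height z 0 = 0` and `height z (i + 1) - height z i` is `1` if `z i = 1`
and `-1` if `z i = 0`. -/
noncomputable def height (z : ℤ → Bool) (i : ℤ) : ℤ :=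
  (∑ j ∈ Finset.Ico 0 i, if z j then 1 else -1) - (∑ j ∈ Finset.Ico i 0, if z j then 1 else -1)

/-- The sequences whose height has lower limit `-∞` in both directions. -/
def recurrentSet : Set (ℤ → Bool) :=
  {z | liminf (fun i : ℤ => ((height z i : ℝ) : EReal)) atTop = ⊥ ∧
    liminf (fun i : ℤ => ((height z i : ℝ) : EReal)) atBot = ⊥}

/-- Enumeration of the ones of `z`: `z_0 + … + z_k` for `k ≥ 0`, `-(z_k + … + z_{-1})` for
`k < 0`. -/
noncomputable def onesIndex (z : ℤ → Bool) (k : ℤ) : ℤ :=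
  if 0 ≤ k then ∑ i ∈ Finset.Icc 0 k, (if z i then 1 else 0)
  else -∑ i ∈ Finset.Icc k (-1), (if z i then 1 else 0)

/-- The last `l < n` with `height z l ≤ height z (n + 1)`. This is a maximum whenever `z` is in
`recurrentSet`. -/
noncomputable def matchIndex (z : ℤ → Bool) (n : ℤ) : ℤ :=
  sSup {l : ℤ | l < n ∧ height z l ≤ height z (n + 1)}

/-- The sequence with brackets placed according to `z` and types chosen by `a`, matching brackets
getting the same type. It is only used for `p.1` in `recurrentSet`. -/
noncomputable def dyckF {m : ℕ} (p : (ℤ → Bool) × (ℤ → Fin m)) (n : ℤ) : DyckLetter m :=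
  if p.1 n then DyckLetter.α (p.2 (onesIndex p.1 n))
  else DyckLetter.β (p.2 (onesIndex p.1 (matchIndex p.1 n)))

/-- The symmetric product measure on `A^ℤ`. -/
noncomputable def symmetricProduct (A : Type*) [MeasurableSpace A] : Measure (ℤ → A) :=
  Measure.infinitePi fun _ => ProbabilityTheory.uniformOn (Set.univ : Set A)

/-- The image of the product of the two symmetric product measures under the map `dyckF`, whose
domain is `recurrentSet ×ˢ univ`, as a measure on the full shift. -/
noncomputable def muFull (m : ℕ) : Measure (ℤ → DyckLetter m) :=
  (((symmetricProduct Bool).prod (symmetricProduct (Fin m))).restrict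
    (recurrentSet ×ˢ Set.univ)).map dyckF

/-- The same measure on the Dyck shift: `muTilde m B = muFull m B` for Borel sets `B` of the Dyck
shift. -/
noncomputable def muTilde (m : ℕ) : Measure (dyckShift m) :=
  (muFull m).comap Subtype.val

/-! The Dyck monoid acts by partial maps on infinite stacks: `α j` pushes `j`, and `β j` pops `j` or
fails. A word is nonzero exactly when it runs on some stack (`mem_dyckLanguage_iff`), and its domain
is then the set of stacks with a prescribed top, of length the number of unmatched closing brackets.
When the height is unbounded below on the left, a point of the shift carries at each time the stack
of types of its open brackets, and its opening letters and their positions determine it.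

Fix `z`. Fitting a word `w` of length `n` prescribes `a` at one coordinate for every bracket opened
in `w` and one for every bracket closed but not opened there; these coordinates are distinct, hence
independent. So the cylinder of `w` has mass `2⁻ⁿ m^{-(openings + unmatched)}` (`muFull_cylSet`).
Position plays no role, which gives shift invariance. Replacing `w` by a word with the same action
and the same number of openings does not change the mass either, in any context.

Double-tail invariance reduces to such replacements (`exists_sameAction`). Let `x` be generic and
let `y` differ from it in a finite window. The stacks on entering the window agree. Those on leaving
it agree too, since the common right tail eventually pops every entry. If the two blocks had
different heights, the entering stack would be eventually periodic, which is a null event. Hence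
heights and opening counts agree, and after the window is extended far enough to the left both
blocks act alike on every stack. A holonomy is therefore, off null sets, a countable union of block
replacements, each preserving the measure.

For the entropy, a word of length `n` carries information `n log 2 + (openings + unmatched) log m`.
Openings average `n / 2`. The unmatched count is the depth reached by a simple random walk, whose
mean is `o(n)` by recurrence (`tendsto_integral_walkDepth_div`). Words compute the entropy because
any finite partition is close to one read off a finite window.

Finally, choosing freely in `n` places one of the `m` opening brackets or a closing bracket gives
`(m + 1)ⁿ` separated points, so the topological entropy is at least `log (m + 1)`, and `(m + 1)² >
4m`. -/

/-! ### The action of words on infinite stacks -/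

namespace DyckLetter

variable {m : ℕ}

/-- The type of a bracket. -/
def label : DyckLetter m → Fin m
  | α j => j
  | β j => j

/-- Whether a bracket is opening. -/
def isOpening : DyckLetter m → Bool
  | α _ => true
  | β _ => false

/-- The alphabet as a disjoint union. -/
def equivSum (m : ℕ) : DyckLetter m ≃ Fin m ⊕ Fin m where
  toFun x := match x with
    | α j => .inl j
    | β j => .inr j
  invFun x := match x with
    | .inl j => α j
    | .inr j => β j
  left_inv x := by cases x <;> rfl
  right_inv x := by cases x <;> rfl

instance : Fintype (DyckLetter m) := Fintype.ofEquiv _ (equivSum m).symm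

instance : DecidableEq (DyckLetter m) := (equivSum m).decidableEq

instance : DiscreteMeasurableSpace (DyckLetter m) := ⟨fun _ => trivial⟩

end DyckLetter

/-- Put a letter on top of an infinite stack. -/
def stackCons {A : Type*} (j : A) (s : ℕ → A) : ℕ → A
  | 0 => j
  | i + 1 => s i

@[simp] theorem stackCons_zero {A : Type*} (j : A) (s : ℕ → A) : stackCons j s 0 = j := rfl

@[simp] theorem stackCons_succ {A : Type*} (j : A) (s : ℕ → A) (i : ℕ) :
    stackCons j s (i + 1) = s i := rfl

section Words

variable {m : ℕ}

/-- `α j` pushes `j`; `β j` pops `j`, and fails if the top of the stack is something else. -/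
def stackStep (s : ℕ → Fin m) : DyckLetter m → Option (ℕ → Fin m)
  | .α j => some (stackCons j s)
  | .β j => if s 0 = j then some (fun i => s (i + 1)) else none

/-- The action of a word on an infinite stack. -/
def stackRun (w : List (DyckLetter m)) (s : ℕ → Fin m) : Option (ℕ → Fin m) :=
  w.foldlM stackStep s

@[simp] theorem stackRun_nil (s : ℕ → Fin m) : stackRun [] s = some s := rfl

theorem stackRun_cons (l : DyckLetter m) (w : List (DyckLetter m)) (s : ℕ → Fin m) :
    stackRun (l :: w) s = (stackStep s l).bind (stackRun w) := rfl

@[simp] theorem stackRun_cons_α (j : Fin m) (w : List (DyckLetter m)) (s : ℕ → Fin m) :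
    stackRun (.α j :: w) s = stackRun w (stackCons j s) := rfl

theorem stackRun_cons_β (j : Fin m) (w : List (DyckLetter m)) (s : ℕ → Fin m) :
    stackRun (.β j :: w) s = if s 0 = j then stackRun w (fun i => s (i + 1)) else none := by
  rw [stackRun_cons, stackStep]
  split_ifs <;> rfl

theorem stackRun_append (u v : List (DyckLetter m)) (s : ℕ → Fin m) :
    stackRun (u ++ v) s = (stackRun u s).bind (stackRun v) := by
  unfold stackRun
  rw [List.foldlM_append]; rfl

/-- The action of the free monoid with zero; `0` fails everywhere. -/
def stackAct (w : WithZero (FreeMonoid (DyckLetter m))) (s : ℕ → Fin m) :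
    Option (ℕ → Fin m) :=
  WithZero.recZeroCoe (motive := fun _ => Option (ℕ → Fin m)) none
    (fun w => stackRun (FreeMonoid.toList w) s) w

@[simp] theorem stackAct_zero (s : ℕ → Fin m) : stackAct 0 s = none := rfl

@[simp] theorem stackAct_coe (w : FreeMonoid (DyckLetter m)) (s : ℕ → Fin m) :
    stackAct (w : WithZero (FreeMonoid (DyckLetter m))) s = stackRun (FreeMonoid.toList w) s := rfl

@[simp] theorem stackAct_one (s : ℕ → Fin m) : stackAct 1 s = some s := rfl

theorem stackAct_mul (u v : WithZero (FreeMonoid (DyckLetter m))) (s : ℕ → Fin m) :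
    stackAct (u * v) s = (stackAct u s).bind (stackAct v) := by
  induction u using WithZero.recZeroCoe with
  | zero => simp
  | coe u =>
    induction v using WithZero.recZeroCoe with
    | zero => cases h : stackAct (u : WithZero (FreeMonoid (DyckLetter m))) s <;> simp
    | coe v =>
      rw [← WithZero.coe_mul, stackAct_coe, FreeMonoid.toList_mul, stackRun_append]
      rfl

/-- Words acting in the same way on stacks. -/
def stackCon (m : ℕ) : Con (WithZero (FreeMonoid (DyckLetter m))) where
  r u v := ∀ s, stackAct u s = stackAct v s
  iseqv := ⟨fun _ _ => rfl, fun h s => (h s).symm, fun h h' s => (h s).trans (h' s)⟩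
  mul' h h' s := by
    rw [stackAct_mul, stackAct_mul, h s]
    exact congrArg _ (funext h')

/-- Push followed by pop satisfies both defining relations, so the Dyck monoid itself acts on
stacks. This inclusion alone suffices to tell words apart from zero. -/
theorem dyckCon_le_stackCon (m : ℕ) : dyckCon m ≤ stackCon m := by
  refine Con.conGen_le.2 fun u v h => ?_
  rcases h with ⟨j⟩ | ⟨i, j, hij⟩ <;> intro s
  · simp [stackRun_cons_β, -WithZero.coe_mul]
  · simp [stackRun_cons_β, hij, -WithZero.coe_mul]

/-! ### Normal forms in the Dyck monoid -/

/-- The word `β_{b₁} … β_{bₖ} α_{a₁} … α_{aₗ}`. -/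
def reducedWord (b a : List (Fin m)) : FreeMonoid (DyckLetter m) :=
  FreeMonoid.ofList (b.map DyckLetter.β ++ a.map DyckLetter.α)

/-- Pushes never fail, and the closing brackets succeed on a stack that begins with `b`. -/
theorem exists_stackRun_reducedWord [NeZero m] (b a : List (Fin m)) :
    ∃ s, stackRun (FreeMonoid.toList (reducedWord b a)) s ≠ none := by
  induction b with
  | nil =>
    have : ∀ s : ℕ → Fin m, stackRun (FreeMonoid.toList (reducedWord [] a)) s ≠ none := by
      induction a with
      | nil => intro s; simp [reducedWord]
      | cons j a ih => intro s; simpa [reducedWord] using ih (stackCons j s)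
    exact ⟨fun _ => 0, this _⟩
  | cons j b ih =>
    obtain ⟨s, hs⟩ := ih
    refine ⟨stackCons j s, ?_⟩
    simpa [reducedWord, stackRun_cons_β] using hs

/-- Induction on letters multiplied from the left: only an `α` meeting a leading `β` interacts with
a reduced word, and it either cancels or gives zero. -/
theorem dyckCon_zero_or_reducedWord (w : FreeMonoid (DyckLetter m)) :
    dyckCon m (w : WithZero (FreeMonoid (DyckLetter m))) 0 ∨
      ∃ b a, dyckCon m (w : WithZero (FreeMonoid (DyckLetter m)))
        (reducedWord b a : FreeMonoid (DyckLetter m)) := by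
  induction w using FreeMonoid.recOn with
  | one => exact Or.inr ⟨[], [], (dyckCon m).refl _⟩
  | of_mul l w ih =>
    rw [WithZero.coe_mul]
    have hl := (dyckCon m).refl (FreeMonoid.of l : WithZero (FreeMonoid (DyckLetter m)))
    rcases ih with ih | ⟨b, a, ih⟩
    · left; simpa using (dyckCon m).mul hl ih
    · have key := (dyckCon m).mul hl ih
      cases l with
      | β j => exact Or.inr ⟨j :: b, a, key⟩
      | α j =>
        cases b with
        | nil => exact Or.inr ⟨[], j :: a, key⟩
        | cons i b =>
          have e : ((FreeMonoid.of (DyckLetter.α j) : FreeMonoid (DyckLetter m)) :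
              WithZero (FreeMonoid (DyckLetter m))) * (reducedWord (i :: b) a) =
              ((FreeMonoid.of (DyckLetter.α j) * FreeMonoid.of (DyckLetter.β i) :
                FreeMonoid (DyckLetter m)) : WithZero (FreeMonoid (DyckLetter m))) *
              (reducedWord b a) := by
            rw [← WithZero.coe_mul, ← WithZero.coe_mul]; rfl
          rw [e] at key
          have hr := (dyckCon m).refl (reducedWord b a : WithZero (FreeMonoid (DyckLetter m)))
          by_cases hij : j = i
          · subst hij
            have h1 : dyckCon m _ 1 := ConGen.Rel.of _ _ (DyckRel.cancel j)
            have := (dyckCon m).trans key ((dyckCon m).mul h1 hr)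
            rw [one_mul] at this
            exact Or.inr ⟨b, a, this⟩
          · have h1 : dyckCon m _ 0 := ConGen.Rel.of _ _ (DyckRel.mismatch j i hij)
            have := (dyckCon m).trans key ((dyckCon m).mul h1 hr)
            rw [zero_mul] at this
            exact Or.inl this

theorem mem_dyckLanguage_iff [NeZero m] {w : FreeMonoid (DyckLetter m)} :
    w ∈ dyckLanguage m ↔ ∃ s, stackRun (FreeMonoid.toList w) s ≠ none := by
  constructor
  · intro h
    rcases dyckCon_zero_or_reducedWord w with h' | ⟨b, a, h'⟩
    · exact absurd h' h
    · obtain ⟨s, hs⟩ := exists_stackRun_reducedWord b a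
      have := dyckCon_le_stackCon m h' s
      exact ⟨s, by rw [stackAct_coe, stackAct_coe] at this; rwa [this]⟩
  · rintro ⟨s, hs⟩ h
    exact hs (dyckCon_le_stackCon m h s)

/-! ### Heights of words, and unmatched closing brackets -/

/-- The number of opening minus the number of closing brackets. -/
def wordHeight : List (DyckLetter m) → ℤ
  | [] => 0
  | .α _ :: w => wordHeight w + 1
  | .β _ :: w => wordHeight w - 1

/-- The number of opening brackets. -/
def openingCount : List (DyckLetter m) → ℕ
  | [] => 0
  | .α _ :: w => openingCount w + 1
  | .β _ :: w => openingCount w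

/-- The number of unmatched closing brackets. -/
def unmatchedCount : List (DyckLetter m) → ℕ
  | [] => 0
  -- Truncated subtraction: an opening bracket absorbs the first unmatched closing bracket to its
  -- right, if there is one.
  | .α _ :: w => unmatchedCount w - 1
  | .β _ :: w => unmatchedCount w + 1

theorem openingCount_append (u v : List (DyckLetter m)) :
    openingCount (u ++ v) = openingCount u + openingCount v := by
  induction u with
  | nil => simp [openingCount]
  | cons l u ih => cases l <;> simp [openingCount, ih] <;> ring

theorem wordHeight_eq (w : List (DyckLetter m)) :
    wordHeight w = 2 * (openingCount w : ℤ) - w.length := by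
  induction w with
  | nil => simp [wordHeight, openingCount]
  | cons l w ih => cases l <;> simp [wordHeight, openingCount, ih] <;> ring

theorem abs_wordHeight_le (w : List (DyckLetter m)) : |wordHeight w| ≤ w.length := by
  induction w with
  | nil => simp [wordHeight]
  | cons l w ih =>
    rw [abs_le] at ih ⊢
    cases l <;> simp [wordHeight] <;> (constructor <;> linarith [ih.1, ih.2])

/-- Letters are added in front. A `β` puts one more condition on the top of the stack. An `α`
supplies the entry tested by the first condition, which then disappears if met and otherwise makes
the domain empty. -/
theorem stackRun_domain (w : List (DyckLetter m)) :
    (∀ s, stackRun w s = none) ∨ ∃ b : ℕ → Fin m, ∀ s, stackRun w s ≠ none ↔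
      ∀ i < unmatchedCount w, s i = b i := by
  induction w with
  | nil =>
    -- For `m = 0` there are no stacks, hence no candidate for `b`.
    by_cases h : Nonempty (ℕ → Fin m)
    · obtain ⟨b⟩ := h
      exact Or.inr ⟨b, fun s => by simp [unmatchedCount]⟩
    · exact Or.inl fun s => absurd ⟨s⟩ h
  | cons l w ih =>
    rcases ih with ih | ⟨b, ih⟩
    · left
      intro s
      cases l with
      | α j => rw [stackRun_cons_α, ih]
      | β j => rw [stackRun_cons_β, ih]; simp
    · cases l with
      | α j =>
        by_cases hj : 0 < unmatchedCount w → b 0 = j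
        · refine Or.inr ⟨fun i => b (i + 1), fun s => ?_⟩
          rw [stackRun_cons_α, ih]
          simp only [unmatchedCount]
          constructor
          · intro h i hi
            exact h (i + 1) (by omega)
          · intro h i hi
            cases i with
            | zero => exact (hj hi).symm
            | succ i => exact h i (by omega)
        · push Not at hj
          left
          intro s
          rw [stackRun_cons_α]
          by_contra hne
          exact hj.2 (((ih _).1 hne 0 hj.1).symm)
      | β j =>
        refine Or.inr ⟨stackCons j b, fun s => ?_⟩
        rw [stackRun_cons_β]
        simp only [unmatchedCount]
        constructor
        · intro h i hi
          by_cases hs : s 0 = j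
          · rw [if_pos hs] at h
            cases i with
            | zero => exact hs
            | succ i => exact (ih _).1 h i (by omega)
          · simp [hs] at h
        · intro h
          rw [if_pos (show s 0 = j from h 0 (by omega))]
          exact (ih _).2 fun i hi => h (i + 1) (by omega)

/-- The domain remembers how many entries it prescribes: if `v` tested more entries than `u`,
altering the first one that `u` ignores would leave the domain of `v` but not that of `u`. A second
letter is needed to alter it. -/
theorem unmatchedCount_eq_of_stackRun_eq (hm : 2 ≤ m) {u v : List (DyckLetter m)}
    (h : ∀ s, stackRun u s = stackRun v s) (hu : ∃ s, stackRun u s ≠ none) :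
    unmatchedCount u = unmatchedCount v := by
  obtain ⟨s₀, hs₀⟩ := hu
  have aux : ∀ {u v : List (DyckLetter m)}, (∀ s, stackRun u s = stackRun v s) →
      stackRun u s₀ ≠ none → unmatchedCount v ≤ unmatchedCount u := by
    intro u v h hu
    have hv : stackRun v s₀ ≠ none := h s₀ ▸ hu
    rcases stackRun_domain u with h1 | ⟨b, hb⟩
    · exact absurd (h1 _) hu
    rcases stackRun_domain v with h2 | ⟨c, hc⟩
    · exact absurd (h2 _) hv
    by_contra! hlt
    have : Nontrivial (Fin m) := Fin.nontrivial_iff_two_le.2 hm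
    obtain ⟨j, hj⟩ := exists_ne (c (unmatchedCount u))
    have h3 : stackRun u (Function.update b (unmatchedCount u) j) ≠ none := by
      refine (hb _).2 fun i hi => ?_
      rw [Function.update_of_ne hi.ne]
    rw [h] at h3
    have := (hc _).1 h3 _ hlt
    rw [Function.update_self] at this
    exact hj this
  exact le_antisymm (aux (fun s => (h s).symm) (h s₀ ▸ hs₀)) (aux h hs₀)

/-- An entry of the stack is moved along as long as it is not popped. -/
theorem stackRun_apply {w : List (DyckLetter m)} {s t : ℕ → Fin m} (h : stackRun w s = some t)
    {i k : ℕ} (hi : ∀ p, p <+: w → 0 ≤ (i : ℤ) + wordHeight p) (hk : (k : ℤ) = i + wordHeight w) :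
    t k = s i := by
  induction w generalizing s i with
  | nil =>
    simp only [stackRun_nil, Option.some.injEq] at h
    simp only [wordHeight, add_zero, Nat.cast_inj] at hk
    rw [h, hk]
  | cons l w ih =>
    cases l with
    | α j =>
      rw [stackRun_cons_α] at h
      refine ih (i := i + 1) h (fun p hp => ?_) ?_
      · have := hi (.α j :: p) (by simpa using hp)
        simp only [wordHeight] at this
        push_cast; linarith
      · simp only [wordHeight] at hk
        push_cast; linarith
    | β j =>
      rw [stackRun_cons_β] at h
      split_ifs at h
      have h0 := hi [.β j] (by simp)
      simp only [wordHeight] at h0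
      obtain ⟨i, rfl⟩ : ∃ i', i = i' + 1 := ⟨i - 1, by omega⟩
      refine ih (i := i) h (fun p hp => ?_) ?_
      · have := hi (.β j :: p) (by simpa using hp)
        simp only [wordHeight] at this
        push_cast at this; linarith
      · simp only [wordHeight] at hk
        push_cast at hk; linarith

theorem stackRun_apply_of_length_le {w : List (DyckLetter m)} {s t : ℕ → Fin m}
    (h : stackRun w s = some t) {i k : ℕ} (hi : w.length ≤ i) (hk : (k : ℤ) = i + wordHeight w) :
    t k = s i := by
  refine stackRun_apply h (fun p hp => ?_) hk
  have h1 := neg_le_of_abs_le (abs_wordHeight_le p)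
  have h2 := hp.length_le
  omega

/-- If a word acts on two stacks which differ in an entry, this entry is not popped. -/
theorem nonneg_of_stackRun_ne_none {w : List (DyckLetter m)} {s t : ℕ → Fin m}
    (hs : stackRun w s ≠ none) (ht : stackRun w t ≠ none) {i : ℕ} (h : s i ≠ t i) :
    0 ≤ (i : ℤ) + wordHeight w := by
  induction w generalizing s t i with
  | nil => simp [wordHeight]
  | cons l w ih =>
    cases l with
    | α j =>
      have := ih (i := i + 1) hs ht h
      simp only [wordHeight]
      push_cast at this; linarith
    | β j =>
      rw [stackRun_cons_β] at hs ht
      split_ifs at hs with h1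
      · split_ifs at ht with h2
        · cases i with
          | zero => exact absurd (h1.trans h2.symm) h
          | succ i =>
            have := ih (i := i) hs ht h
            simp only [wordHeight]
            push_cast; linarith
        · exact absurd rfl ht
      · exact absurd rfl hs

/-- The action of a word of length `n` only looks at the first `n` entries. -/
theorem exists_stackRun_eq {w : List (DyckLetter m)} {s t : ℕ → Fin m} (h : stackRun w s = some t)
    {k : ℕ} {s' : ℕ → Fin m} (hs : ∀ i < w.length + k, s' i = s i) :
    ∃ t', stackRun w s' = some t' ∧ ∀ i < k, t' i = t i := by
  induction w generalizing s s' k with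
  | nil =>
    simp only [stackRun_nil, Option.some.injEq] at h
    refine ⟨s', rfl, fun i hi => h ▸ hs i (by simpa using hi)⟩
  | cons l w ih =>
    cases l with
    | α j =>
      refine ih h (s' := stackCons j s') fun i hi => ?_
      cases i with
      | zero => rfl
      | succ i => exact hs i (by simp; omega)
    | β j =>
      rw [stackRun_cons_β] at h ⊢
      split_ifs at h with h0
      rw [if_pos ((hs 0 (by simp)).trans h0)]
      exact ih h (s' := fun i => s' (i + 1)) fun i hi => hs _ (by simp; omega)

end Words

/-! ### Heights -/

section Heights

theorem height_succ (z : ℤ → Bool) (i : ℤ) :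
    height z (i + 1) = height z i + if z i then 1 else -1 := by
  unfold height
  rcases le_or_gt 0 i with hi | hi
  · have e1 : Finset.Ico (i + 1) 0 = ∅ := Finset.Ico_eq_empty (by omega)
    have e2 : Finset.Ico i 0 = ∅ := Finset.Ico_eq_empty (by omega)
    have e3 : Finset.Ico 0 (i + 1) = insert i (Finset.Ico 0 i) := by
      ext j; simp only [Finset.mem_Ico, Finset.mem_insert]; omega
    rw [e1, e2, e3, Finset.sum_insert (by simp)]
    simp; ring
  · have e1 : Finset.Ico 0 (i + 1) = ∅ := Finset.Ico_eq_empty (by omega)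
    have e2 : Finset.Ico 0 i = ∅ := Finset.Ico_eq_empty (by omega)
    have e3 : Finset.Ico i 0 = insert i (Finset.Ico (i + 1) 0) := by
      ext j; simp only [Finset.mem_Ico, Finset.mem_insert]; omega
    rw [e1, e2, e3, Finset.sum_insert (by simp)]
    simp

theorem height_zero (z : ℤ → Bool) : height z 0 = 0 := by simp [height]

theorem height_succ_of_true {z : ℤ → Bool} {i : ℤ} (h : z i = true) :
    height z (i + 1) = height z i + 1 := by rw [height_succ, if_pos h]

theorem height_succ_of_false {z : ℤ → Bool} {i : ℤ} (h : z i = false) :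
    height z (i + 1) = height z i - 1 := by rw [height_succ, if_neg (by simp [h])]; ring

theorem abs_height_le (z : ℤ → Bool) (i : ℤ) : |height z i| ≤ |i| := by
  induction i using Int.induction_on with
  | zero => simp [height_zero]
  | succ n ih =>
    have := height_succ z n
    rw [abs_le] at ih
    rw [abs_of_nonneg (show (0 : ℤ) ≤ n by omega)] at ih
    rw [abs_of_nonneg (show (0 : ℤ) ≤ n + 1 by omega), abs_le]
    split_ifs at this <;> constructor <;> omega
  | pred n ih =>
    have := height_succ z (-n - 1)
    rw [sub_add_cancel] at this
    rw [abs_le] at ih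
    rw [abs_of_nonpos (show -(n : ℤ) ≤ 0 by omega)] at ih
    rw [abs_of_nonpos (show -(n : ℤ) - 1 ≤ 0 by omega), abs_le]
    split_ifs at this <;> constructor <;> omega

theorem height_sub_height_congr {z z' : ℤ → Bool} {l : ℤ} (n : ℕ)
    (h : ∀ k, l ≤ k → k < l + n → z k = z' k) :
    height z (l + n) - height z l = height z' (l + n) - height z' l := by
  induction n with
  | zero => simp
  | succ n ih =>
    have h1 := height_succ z (l + n)
    have h2 := height_succ z' (l + n)
    rw [h (l + n) (by omega) (by push_cast; omega)] at h1
    have h3 := ih fun k hk hk' => h k hk (by push_cast; omega)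
    push_cast
    rw [← add_assoc, h1, h2]
    linarith

theorem height_sub_height_of_le {z z' : ℤ → Bool} {l r : ℤ} (hlr : l ≤ r)
    (h : ∀ k, l ≤ k → k < r → z k = z' k) :
    height z r - height z l = height z' r - height z' l := by
  obtain ⟨n, rfl⟩ := Int.le.dest hlr
  exact height_sub_height_congr n h

/-- The height is unbounded below on the left. -/
def LeftUnbounded (z : ℤ → Bool) : Prop := ∀ r c : ℤ, ∃ l < r, height z l ≤ c

/-- The height is unbounded below on the right. -/
def RightUnbounded (z : ℤ → Bool) : Prop := ∀ r c : ℤ, ∃ l > r, height z l ≤ c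

theorem liminf_height_eq_bot_iff (z : ℤ → Bool) (f : Filter ℤ) :
    liminf (fun i : ℤ => ((height z i : ℝ) : EReal)) f = ⊥ ↔
      ∀ c : ℤ, ∃ᶠ i in f, height z i ≤ c := by
  constructor
  · intro h c
    by_contra hc
    rw [not_frequently] at hc
    have : ((c : ℝ) : EReal) ≤ liminf (fun i : ℤ => ((height z i : ℝ) : EReal)) f := by
      refine le_liminf_of_le ⟨⊤, fun _ _ => le_top⟩ (hc.mono fun i hi => ?_)
      have : c ≤ height z i := by omega
      exact_mod_cast this
    rw [h, le_bot_iff] at this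
    exact EReal.coe_ne_bot _ this
  · intro h
    rw [EReal.eq_bot_iff_forall_lt]
    intro y
    obtain ⟨c, hc⟩ := exists_int_lt y
    refine lt_of_le_of_lt (b := ((c : ℝ) : EReal)) ?_ (by exact_mod_cast hc)
    refine liminf_le_of_frequently_le' ((h c).mono fun i hi => ?_)
    exact_mod_cast hi

theorem mem_recurrentSet_iff {z : ℤ → Bool} :
    z ∈ recurrentSet ↔ RightUnbounded z ∧ LeftUnbounded z := by
  unfold recurrentSet RightUnbounded LeftUnbounded
  rw [Set.mem_ofPred_eq, liminf_height_eq_bot_iff, liminf_height_eq_bot_iff]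
  simp only [frequently_atTop', frequently_atBot']
  constructor
  · rintro ⟨h, h'⟩
    exact ⟨fun r c => h c r, fun r c => h' c r⟩
  · rintro ⟨h, h'⟩
    exact ⟨fun c r => h r c, fun c r => h' r c⟩

/-- Heights change by at most one per step, so very low values occur only far away and the position
needs no separate control. -/
theorem leftUnbounded_of_forall {z : ℤ → Bool} (h : ∀ c : ℕ, ∃ l ≤ 0, height z l < -c) :
    LeftUnbounded z := by
  intro r c
  obtain ⟨l, hl, hlc⟩ := h (r.natAbs + c.natAbs)
  refine ⟨l, ?_, by omega⟩
  have h1 := neg_le_of_abs_le (abs_height_le z l)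
  rw [abs_of_nonpos hl] at h1
  omega

theorem rightUnbounded_of_forall {z : ℤ → Bool} (h : ∀ c : ℕ, ∃ l ≥ 0, height z l < -c) :
    RightUnbounded z := by
  intro r c
  obtain ⟨l, hl, hlc⟩ := h (r.natAbs + c.natAbs)
  refine ⟨l, ?_, by omega⟩
  have h1 := neg_le_of_abs_le (abs_height_le z l)
  rw [abs_of_nonneg hl] at h1
  omega

/-- To the left of `r` the two heights differ by a constant. -/
theorem LeftUnbounded.congr {z z' : ℤ → Bool} (hz : LeftUnbounded z) {r : ℤ}
    (h : ∀ k < r, z k = z' k) : LeftUnbounded z' := by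
  intro r' c
  obtain ⟨l, hl, hlc⟩ := hz (min r r') (c + height z r - height z' r)
  refine ⟨l, by omega, ?_⟩
  have := height_sub_height_of_le (z := z) (z' := z') (l := l) (r := r) (by omega)
    fun k _ hk => h k hk
  omega

/-! ### Positions of the open brackets -/

/-- The position of the bracket at depth `i` among those which are open at time `r`. -/
noncomputable def openPos (z : ℤ → Bool) (r : ℤ) (i : ℕ) : ℤ :=
  sSup {l : ℤ | l < r ∧ height z l ≤ height z r - 1 - i}

theorem isGreatest_openPos {z : ℤ → Bool} (hz : LeftUnbounded z) (r : ℤ) (i : ℕ) :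
    IsGreatest {l : ℤ | l < r ∧ height z l ≤ height z r - 1 - i} (openPos z r i) := by
  obtain ⟨l, hl⟩ := hz r (height z r - 1 - i)
  have hb : BddAbove {l : ℤ | l < r ∧ height z l ≤ height z r - 1 - i} :=
    ⟨r, fun l hl => hl.1.le⟩
  exact ⟨Int.csSup_mem ⟨l, hl⟩ hb, fun l hl => le_csSup hb hl⟩

theorem openPos_lt {z : ℤ → Bool} (hz : LeftUnbounded z) (r : ℤ) (i : ℕ) : openPos z r i < r :=
  (isGreatest_openPos hz r i).1.1

theorem lt_height_of_openPos_lt {z : ℤ → Bool} (hz : LeftUnbounded z) {r : ℤ} {i : ℕ} {l : ℤ}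
    (h : openPos z r i < l) (h' : l < r) : height z r - 1 - i < height z l := by
  by_contra hc
  exact absurd ((isGreatest_openPos hz r i).2 ⟨h', not_lt.1 hc⟩) (not_le.2 h)

/-- Discrete intermediate values: the steps are `±1`, so the last place at or below a level lies
exactly on it and is followed by an up-step. -/
theorem height_openPos_add_one {z : ℤ → Bool} (hz : LeftUnbounded z) (r : ℤ) (i : ℕ) :
    z (openPos z r i) = true ∧ height z (openPos z r i) = height z r - 1 - i := by
  have h1 := (isGreatest_openPos hz r i).1
  have h2 : height z r - i ≤ height z (openPos z r i + 1) := by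
    rcases (Int.add_one_le_of_lt h1.1).eq_or_lt with h | h
    · rw [h]; omega
    · have := lt_height_of_openPos_lt hz (lt_add_one _) h
      omega
  have h3 := height_succ z (openPos z r i)
  split_ifs at h3 with h
  · exact ⟨h, by have := h1.2; omega⟩
  · have := h1.2; omega

theorem apply_openPos {z : ℤ → Bool} (hz : LeftUnbounded z) (r : ℤ) (i : ℕ) :
    z (openPos z r i) = true := (height_openPos_add_one hz r i).1

theorem height_openPos {z : ℤ → Bool} (hz : LeftUnbounded z) (r : ℤ) (i : ℕ) :
    height z (openPos z r i) = height z r - 1 - i := (height_openPos_add_one hz r i).2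

theorem openPos_injective {z : ℤ → Bool} (hz : LeftUnbounded z) (r : ℤ) :
    Function.Injective (openPos z r) := by
  intro i j h
  have h1 := height_openPos hz r i
  rw [h, height_openPos hz r j] at h1
  omega

theorem openPos_eq {z : ℤ → Bool} (hz : LeftUnbounded z) {r : ℤ} {i : ℕ} {p : ℤ}
    (h1 : p < r) (h2 : height z p ≤ height z r - 1 - i)
    (h3 : ∀ l, p < l → l < r → height z r - 1 - i < height z l) : openPos z r i = p := by
  refine (isGreatest_openPos hz r i).unique ⟨⟨h1, h2⟩, fun l hl => ?_⟩
  by_contra hc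
  have := h3 l (not_le.1 hc) hl.1
  have := hl.2
  omega

/-- This and the next two lemmas show that the positions of open brackets evolve as a stack: an
up-step pushes, a down-step pops. -/
theorem openPos_succ_zero {z : ℤ → Bool} (hz : LeftUnbounded z) {r : ℤ} (h : z r = true) :
    openPos z (r + 1) 0 = r :=
  openPos_eq hz (by omega) (by have := height_succ_of_true h; simp; omega) fun l _ _ => by omega

theorem openPos_succ_succ {z : ℤ → Bool} (hz : LeftUnbounded z) {r : ℤ} (h : z r = true) (i : ℕ) :
    openPos z (r + 1) (i + 1) = openPos z r i := by
  have h0 := height_succ_of_true h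
  have h1 := openPos_lt hz r i
  refine openPos_eq hz (by omega) ?_ fun l hl hl' => ?_
  · have := height_openPos hz r i
    push_cast; omega
  · push_cast
    rcases (Int.lt_add_one_iff.1 hl').eq_or_lt with rfl | hl''
    · omega
    · have := lt_height_of_openPos_lt hz hl hl''
      omega

theorem openPos_succ_of_false {z : ℤ → Bool} (hz : LeftUnbounded z) {r : ℤ} (h : z r = false)
    (i : ℕ) : openPos z (r + 1) i = openPos z r (i + 1) := by
  have h0 := height_succ_of_false h
  have h1 := openPos_lt hz r (i + 1)
  refine openPos_eq hz (by omega) ?_ fun l hl hl' => ?_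
  · have := height_openPos hz r (i + 1)
    push_cast at this; omega
  · rcases (Int.lt_add_one_iff.1 hl').eq_or_lt with rfl | hl''
    · omega
    · have := lt_height_of_openPos_lt hz hl hl''
      push_cast at this; omega

/-- A closing bracket lowers the height by one, so it matches the topmost bracket still open. -/
theorem matchIndex_eq_openPos {z : ℤ → Bool} {n : ℤ} (h : z n = false) :
    matchIndex z n = openPos z n 0 := by
  unfold matchIndex openPos
  rw [height_succ_of_false h]
  simp

theorem openPos_congr {z z' : ℤ → Bool} {r : ℤ} (h : ∀ k < r, z k = z' k) (i : ℕ) :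
    openPos z r i = openPos z' r i := by
  unfold openPos
  congr 1
  ext l
  simp only [Set.mem_ofPred_eq, and_congr_right_iff]
  intro hl
  have := height_sub_height_of_le (z := z) (z' := z') hl.le fun k _ hk => h k hk
  omega

/-! ### Enumeration of the ones -/

theorem onesIndex_lt_onesIndex {z : ℤ → Bool} {k k' : ℤ} (hkk' : k < k') (h : z k = true)
    (h' : z k' = true) : onesIndex z k < onesIndex z k' := by
  have nonneg : ∀ i, (0 : ℤ) ≤ if z i then 1 else 0 := fun i => by split_ifs <;> simp
  unfold onesIndex
  split_ifs with h1 h2 h2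
  · refine Finset.sum_lt_sum_of_subset (i := k') (fun i hi => ?_) ?_ ?_ ?_ fun i _ _ => nonneg i
    · simp only [Finset.mem_Icc] at hi ⊢; omega
    · simp only [Finset.mem_Icc]; omega
    · simp only [Finset.mem_Icc]; omega
    · simp [h']
  · omega
  · have a1 : (if z k then (1 : ℤ) else 0) ≤ ∑ i ∈ Finset.Icc k (-1), (if z i then 1 else 0) :=
      Finset.single_le_sum (f := fun i => if z i then (1 : ℤ) else 0) (fun i _ => nonneg i)
        (by simp only [Finset.mem_Icc]; omega)
    have a2 : 0 ≤ ∑ i ∈ Finset.Icc 0 k', (if z i then (1 : ℤ) else 0) :=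
      Finset.sum_nonneg fun i _ => nonneg i
    rw [if_pos h] at a1
    omega
  · rw [neg_lt_neg_iff]
    refine Finset.sum_lt_sum_of_subset (i := k) (fun i hi => ?_) ?_ ?_ ?_ fun i _ _ => nonneg i
    · simp only [Finset.mem_Icc] at hi ⊢; omega
    · simp only [Finset.mem_Icc]; omega
    · simp only [Finset.mem_Icc]; omega
    · simp [h]

/-- Distinct opening brackets thus read distinct, hence independent, coordinates of `a`. -/
theorem onesIndex_injOn (z : ℤ → Bool) : Set.InjOn (onesIndex z) {k | z k = true} := by
  intro k hk k' hk' h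
  rcases lt_trichotomy k k' with h1 | h1 | h1
  · exact absurd h (onesIndex_lt_onesIndex h1 hk hk').ne
  · exact h1
  · exact absurd h (onesIndex_lt_onesIndex h1 hk' hk).ne'

end Heights

/-! ### Blocks of sequences -/

section Blocks

/-- The block `x_r … x_{r+n-1}` as a list. -/
def blockList {A : Type*} (x : ℤ → A) (r : ℤ) (n : ℕ) : List A :=
  (List.range n).map fun i : ℕ => x (r + i)

theorem toList_block {A : Type*} (x : ℤ → A) (r : ℤ) (n : ℕ) :
    FreeMonoid.toList (block x r n) = blockList x r n := by
  simp [block, blockList, ← List.map_eq_flatMap]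

theorem blockList_zero {A : Type*} (x : ℤ → A) (r : ℤ) : blockList x r 0 = [] := rfl

theorem blockList_succ {A : Type*} (x : ℤ → A) (r : ℤ) (n : ℕ) :
    blockList x r (n + 1) = x r :: blockList x (r + 1) n := by
  unfold blockList
  rw [List.range_succ_eq_map, List.map_cons, List.map_map]
  simp only [Nat.cast_zero, add_zero, List.cons.injEq, true_and]
  refine List.map_congr_left fun i _ => congrArg x ?_
  push_cast; ring

@[simp] theorem length_blockList {A : Type*} (x : ℤ → A) (r : ℤ) (n : ℕ) :
    (blockList x r n).length = n := by simp [blockList]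

theorem blockList_add {A : Type*} (x : ℤ → A) (r : ℤ) (p q : ℕ) :
    blockList x r (p + q) = blockList x r p ++ blockList x (r + p) q := by
  induction p generalizing r with
  | zero => simp [blockList]
  | succ p ih =>
    rw [Nat.succ_add, Nat.succ_eq_add_one, blockList_succ, blockList_succ, ih]
    simp only [List.cons_append, List.cons.injEq, true_and]
    congr 2
    push_cast; ring

theorem blockList_eq_iff {A : Type*} {x y : ℤ → A} {r : ℤ} {n : ℕ} :
    blockList x r n = blockList y r n ↔ ∀ k, r ≤ k → k < r + n → x k = y k := by
  unfold blockList
  rw [List.map_inj_left]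
  constructor
  · intro h k hk hk'
    have := h (k - r).toNat (List.mem_range.2 (by omega))
    rwa [Int.toNat_of_nonneg (by omega), add_sub_cancel] at this
  · intro h i hi
    exact h _ (by omega) (by have := List.mem_range.1 hi; omega)

theorem eq_blockList_of_initial_segment {A : Type*} {x : ℤ → A} {r : ℤ} {n : ℕ} {p : List A}
    (h : p <+: blockList x r n) : p.length ≤ n ∧ p = blockList x r p.length := by
  have h1 := h.length_le
  rw [length_blockList] at h1
  refine ⟨h1, ?_⟩
  obtain ⟨q, rfl⟩ := Nat.exists_eq_add_of_le h1
  rw [blockList_add] at h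
  obtain ⟨s, hs⟩ := h
  exact (List.append_inj hs (by simp)).1

variable {m : ℕ}

/-- The positions of the opening brackets. -/
def openPattern (x : ℤ → DyckLetter m) (k : ℤ) : Bool := (x k).isOpening

theorem wordHeight_blockList (x : ℤ → DyckLetter m) (r : ℤ) (n : ℕ) :
    wordHeight (blockList x r n) = height (openPattern x) (r + n) - height (openPattern x) r := by
  induction n generalizing r with
  | zero => simp [blockList_zero, wordHeight]
  | succ n ih =>
    have h1 := height_succ (openPattern x) r
    have h2 := ih (r + 1)
    rw [show r + 1 + (n : ℤ) = r + (n + 1 : ℕ) by push_cast; ring] at h2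
    rw [blockList_succ]
    unfold openPattern at *
    cases h : x r with
    | α j => simp only [h, DyckLetter.isOpening, wordHeight] at *; simp at h1; omega
    | β j => simp only [h, DyckLetter.isOpening, wordHeight] at *; simp at h1; omega

/-- Brackets placed according to `z`, an opening bracket at `k` having type `l k`, and matching
brackets having the same type. -/
noncomputable def bracketSeq (z : ℤ → Bool) (l : ℤ → Fin m) (n : ℤ) : DyckLetter m :=
  if z n then .α (l n) else .β (l (matchIndex z n))

theorem dyckF_eq_bracketSeq (p : (ℤ → Bool) × (ℤ → Fin m)) :
    dyckF p = bracketSeq p.1 (fun k => p.2 (onesIndex p.1 k)) := rfl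

theorem bracketSeq_of_true {z : ℤ → Bool} {l : ℤ → Fin m} {n : ℤ} (h : z n = true) :
    bracketSeq z l n = .α (l n) := by rw [bracketSeq, if_pos h]

theorem bracketSeq_of_false {z : ℤ → Bool} {l : ℤ → Fin m} {n : ℤ} (h : z n = false) :
    bracketSeq z l n = .β (l (openPos z n 0)) := by
  rw [bracketSeq, if_neg (by simp [h]), matchIndex_eq_openPos h]

theorem openPattern_bracketSeq (z : ℤ → Bool) (l : ℤ → Fin m) :
    openPattern (bracketSeq z l) = z := by
  funext n
  unfold openPattern
  cases h : z n
  · rw [bracketSeq_of_false h]; rfl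
  · rw [bracketSeq_of_true h]; rfl

/-- The types of the brackets which are open at time `r`. -/
noncomputable def stackAt (z : ℤ → Bool) (l : ℤ → Fin m) (r : ℤ) (i : ℕ) : Fin m :=
  l (openPos z r i)

theorem stackAt_succ_of_true {z : ℤ → Bool} (hz : LeftUnbounded z) (l : ℤ → Fin m) {r : ℤ}
    (h : z r = true) : stackAt z l (r + 1) = stackCons (l r) (stackAt z l r) := by
  funext i
  cases i with
  | zero => rw [stackAt, openPos_succ_zero hz h]; rfl
  | succ i => rw [stackAt, openPos_succ_succ hz h]; rfl

theorem stackAt_succ_of_false {z : ℤ → Bool} (hz : LeftUnbounded z) (l : ℤ → Fin m) {r : ℤ}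
    (h : z r = false) : stackAt z l (r + 1) = fun i => stackAt z l r (i + 1) := by
  funext i
  rw [stackAt, openPos_succ_of_false hz h]; rfl

/-- A closing bracket takes its type from the top of the current stack, so the pop always succeeds.
-/
theorem stackRun_bracketSeq {z : ℤ → Bool} (hz : LeftUnbounded z) (l : ℤ → Fin m) (r : ℤ) (n : ℕ) :
    stackRun (blockList (bracketSeq z l) r n) (stackAt z l r) = some (stackAt z l (r + n)) := by
  induction n generalizing r with
  | zero => simp [blockList_zero]
  | succ n ih =>
    rw [blockList_succ]
    have ih := ih (r + 1)
    rw [show r + 1 + (n : ℤ) = r + (n + 1 : ℕ) by push_cast; ring] at ih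
    cases h : z r
    · rw [bracketSeq_of_false h, stackRun_cons_β, if_pos (by rfl), ← ih, stackAt_succ_of_false hz l h]
    · rw [bracketSeq_of_true h, stackRun_cons_α, ← ih, stackAt_succ_of_true hz l h]

theorem bracketSeq_mem_dyckShift [NeZero m] {z : ℤ → Bool} (hz : LeftUnbounded z)
    (l : ℤ → Fin m) : bracketSeq z l ∈ dyckShift m := by
  intro r n
  rw [mem_dyckLanguage_iff]
  exact ⟨stackAt z l r, by rw [toList_block, stackRun_bracketSeq hz]; simp⟩

/-- Running through a block puts the types of the brackets opened there on the stack. -/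
theorem stackRun_blockList_apply {x : ℤ → DyckLetter m} (hz : LeftUnbounded (openPattern x))
    {r : ℤ} {i q : ℕ} (hq : r - q ≤ openPos (openPattern x) r i) {s t : ℕ → Fin m}
    (h : stackRun (blockList x (r - q) q) s = some t) :
    t i = (x (openPos (openPattern x) r i)).label := by
  set p := openPos (openPattern x) r i with hp
  have hpr : p < r := openPos_lt hz r i
  have hpz : openPattern x p = true := apply_openPos hz r i
  obtain ⟨p₁, hp₁⟩ := Int.le.dest hq
  obtain ⟨p₂, hp₂⟩ := Int.le.dest (Int.add_one_le_of_lt hpr)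
  obtain rfl : q = p₁ + (p₂ + 1) := by omega
  rw [blockList_add, blockList_succ, hp₁, stackRun_append] at h
  cases hu : stackRun (blockList x (r - (p₁ + (p₂ + 1) : ℕ)) p₁) s with
  | none => rw [hu] at h; simp at h
  | some u =>
    obtain ⟨j, hj⟩ : ∃ j, x p = .α j := by
      unfold openPattern at hpz
      cases hxp : x p with
      | α j => exact ⟨j, rfl⟩
      | β j => rw [hxp] at hpz; simp [DyckLetter.isOpening] at hpz
    rw [hu, Option.bind_some, hj, stackRun_cons_α] at h
    have hh := height_openPos hz r i
    have hh' := height_succ_of_true hpz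
    rw [← hp] at hh
    -- Between `p + 1` and `r` the height stays at or above its value at `p + 1`, so the letter
    -- pushed at `p` is never popped and ends at depth `i`.
    have h0 : t i = stackCons j u 0 := by
      refine stackRun_apply h (i := 0) (fun w hw => ?_) ?_
      · obtain ⟨hw1, hw2⟩ := eq_blockList_of_initial_segment hw
        rw [hw2, wordHeight_blockList]
        rcases (show p + 1 + (w.length : ℤ) ≤ r by omega).eq_or_lt with e | e
        · rw [e]; simp; omega
        · have := lt_height_of_openPos_lt hz (i := i) (show p < p + 1 + (w.length : ℤ) by omega) e
          simp; omega
      · rw [wordHeight_blockList, hp₂]; simp; omega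
    rw [h0, hj]; rfl

/-- A point of the Dyck shift is determined by its opening brackets. -/
theorem eq_bracketSeq_of_mem_dyckShift [NeZero m] {x : ℤ → DyckLetter m} (hx : x ∈ dyckShift m)
    (hz : LeftUnbounded (openPattern x)) :
    x = bracketSeq (openPattern x) (fun k => (x k).label) := by
  funext n
  cases h : openPattern x n
  · rw [bracketSeq_of_false h]
    obtain ⟨q, hq⟩ := Int.le.dest (openPos_lt hz n 0).le
    -- This block runs from the match `n - q` of `n` to `n` itself; just before `n` the letter
    -- pushed at the match is on top, so the final pop must have its type.
    have hmem := hx (n - q) (q + 1)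
    rw [mem_dyckLanguage_iff] at hmem
    obtain ⟨s, hs⟩ := hmem
    obtain ⟨j, hj⟩ : ∃ j, x n = .β j := by
      unfold openPattern at h
      cases hxn : x n with
      | β j => exact ⟨j, rfl⟩
      | α j => rw [hxn] at h; simp [DyckLetter.isOpening] at h
    rw [toList_block, blockList_add, stackRun_append, sub_add_cancel] at hs
    cases ht : stackRun (blockList x (n - q) q) s with
    | none => rw [ht] at hs; simp at hs
    | some t =>
      rw [← stackRun_blockList_apply hz (by omega) ht, hj]
      rw [ht, blockList_succ, blockList_zero, hj, Option.bind_some, stackRun_cons_β] at hs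
      by_cases hc : t 0 = j
      · rw [hc]
      · rw [if_neg hc] at hs; exact absurd rfl hs
  · rw [bracketSeq_of_true h]
    unfold openPattern at h
    cases hxn : x n with
    | α i => rfl
    | β i => rw [hxn] at h; simp [DyckLetter.isOpening] at h

end Blocks

/-! ### Product measures -/

section ProductMeasures

open Measure ProbabilityTheory

variable {A ι κ : Type*} [MeasurableSpace A]

theorem map_comp_infinitePi (ν : Measure A) [IsProbabilityMeasure ν] {f : κ → ι}
    (hf : Function.Injective f) :
    (infinitePi fun _ : ι => ν).map (fun a k => a (f k)) = infinitePi fun _ : κ => ν := by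
  refine eq_infinitePi _ fun s t ht => ?_
  rw [map_apply (by fun_prop) (.pi s.countable_toSet fun _ _ => ht _)]
  have e : (fun (a : ι → A) k => a (f k)) ⁻¹' ((s : Set κ).pi t) =
      Set.pi (s.map ⟨f, hf⟩ : Finset ι) (Function.extend f t fun _ => Set.univ) := by
    ext a
    simp [Set.mem_pi, hf.extend_apply]
  rw [e, infinitePi_pi, Finset.prod_map]
  · simp [hf.extend_apply]
  · intro i hi
    obtain ⟨k, _, rfl⟩ := Finset.mem_map.1 hi
    simpa [hf.extend_apply] using ht k

theorem measurable_stackCons :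
    Measurable fun p : A × (ℕ → A) => stackCons p.1 p.2 := by
  refine measurable_pi_lambda _ fun i => ?_
  cases i with
  | zero => exact measurable_fst
  | succ i => exact (measurable_pi_apply i).comp measurable_snd

theorem map_stackCons_infinitePi (ν : Measure A) [IsProbabilityMeasure ν] :
    (ν.prod (infinitePi fun _ : ℕ => ν)).map (fun p => stackCons p.1 p.2) =
      infinitePi fun _ : ℕ => ν := by
  classical
  refine eq_infinitePi _ fun s t ht => ?_
  rw [map_apply measurable_stackCons (.pi s.countable_toSet fun _ _ => ht _)]
  obtain ⟨N, hN⟩ := s.exists_nat_subset_range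
  set t' : ℕ → Set A := fun i => if i ∈ s then t i else Set.univ with ht'
  have ht'm : ∀ i, MeasurableSet (t' i) := fun i => by
    rw [ht']; dsimp only; split_ifs
    exacts [ht i, .univ]
  have e : (fun p : A × (ℕ → A) => stackCons p.1 p.2) ⁻¹' ((s : Set ℕ).pi t) =
      t' 0 ×ˢ Set.pi (Finset.range N : Finset ℕ) (fun i => t' (i + 1)) := by
    ext ⟨a, w⟩
    simp only [Set.mem_preimage, Set.mem_pi, SetLike.mem_coe, Set.mem_prod, ht']
    constructor
    · intro h
      refine ⟨?_, fun i _ => ?_⟩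
      · split_ifs with h0
        exacts [h 0 h0, trivial]
      · split_ifs with h0
        exacts [h (i + 1) h0, trivial]
    · rintro ⟨h, h'⟩ i hi
      cases i with
      | zero => simpa [hi] using h
      | succ i =>
        have := h' i (by have := Finset.mem_range.1 (hN hi); simp; omega)
        simpa [hi] using this
  rw [e, prod_prod, infinitePi_pi _ fun i _ => ht'm _, mul_comm,
    ← Finset.prod_range_succ' (fun i => ν (t' i))]
  have h2 : s ⊆ Finset.range (N + 1) := hN.trans (Finset.range_mono (Nat.le_succ N))
  rw [← Finset.prod_subset h2 (f := fun i => ν (t' i))]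
  · exact Finset.prod_congr rfl fun i hi => by simp [ht', hi]
  · intro i _ hi; simp [ht', hi]

theorem uniformOn_univ_singleton [Fintype A] [MeasurableSingletonClass A] (a : A) :
    uniformOn (Set.univ : Set A) {a} = (Fintype.card A : ENNReal)⁻¹ := by
  rw [uniformOn_univ, count_singleton, one_div]

/-- Prescribing the letters at the places `f k`. -/
theorem symmetricProduct_box [Fintype A] [Nonempty A] [MeasurableSingletonClass A]
    [Fintype κ] {f : κ → ℤ} (hf : Function.Injective f) (c : κ → A) :
    symmetricProduct A {a | ∀ k, a (f k) = c k} =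
      ((Fintype.card A : ENNReal)⁻¹) ^ Fintype.card κ := by
  have e : {a : ℤ → A | ∀ k, a (f k) = c k} = (fun a k => a (f k)) ⁻¹' {c} := by
    ext a; simp [funext_iff]
  rw [e, ← map_apply (by fun_prop) (measurableSet_singleton c), symmetricProduct,
    map_comp_infinitePi _ hf, infinitePi_singleton_of_fintype]
  simp [uniformOn_univ_singleton]

end ProductMeasures

/-! ### The random walk -/

section RandomWalk

open ProbabilityTheory

/-- Independent fair coins. -/
noncomputable def coinMeasure : Measure (ℕ → Bool) :=
  Measure.infinitePi fun _ => uniformOn Set.univ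

instance : IsProbabilityMeasure coinMeasure := by unfold coinMeasure; infer_instance

/-- Conditioning on the first step, the source of all recursions for the walk. -/
theorem integral_coinMeasure {f : (ℕ → Bool) → ℝ} (hf : Integrable f coinMeasure) :
    ∫ w, f w ∂coinMeasure = (1 / 2) * ∫ w, f (stackCons true w) ∂coinMeasure +
      (1 / 2) * ∫ w, f (stackCons false w) ∂coinMeasure := by
  have h := map_stackCons_infinitePi (uniformOn (Set.univ : Set Bool))
  change _ = coinMeasure at h
  have hi : Integrable f (((uniformOn (Set.univ : Set Bool)).prod coinMeasure).map
      fun p => stackCons p.1 p.2) := by rw [coinMeasure, h]; exact hf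
  have e : ∫ w, f w ∂coinMeasure = ∫ p, f (stackCons p.1 p.2)
      ∂((uniformOn (Set.univ : Set Bool)).prod coinMeasure) := by
    rw [← integral_map measurable_stackCons.aemeasurable hi.aestronglyMeasurable]
    rw [coinMeasure, h]; rfl
  rw [e, integral_prod (fun p : Bool × (ℕ → Bool) => f (stackCons p.1 p.2))
    (hi.comp_measurable measurable_stackCons), integral_fintype]
  · simp only [measureReal_def, uniformOn_univ_singleton]
    simp
  · exact Integrable.of_finite

/-- The depth below its starting point which the walk reaches within `n` steps. -/
def walkDepth : ℕ → (ℕ → Bool) → ℕ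
  | 0, _ => 0
  | n + 1, w => if w 0 then walkDepth n (fun i => w (i + 1)) - 1
      else walkDepth n (fun i => w (i + 1)) + 1

/-- The number of up-steps among the first `n`. -/
def upCount : ℕ → (ℕ → Bool) → ℕ
  | 0, _ => 0
  | n + 1, w => if w 0 then upCount n (fun i => w (i + 1)) + 1
      else upCount n (fun i => w (i + 1))

@[simp] theorem walkDepth_zero (w : ℕ → Bool) : walkDepth 0 w = 0 := rfl

@[simp] theorem walkDepth_succ_true (n : ℕ) (w : ℕ → Bool) :
    walkDepth (n + 1) (stackCons true w) = walkDepth n w - 1 := rfl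

@[simp] theorem walkDepth_succ_false (n : ℕ) (w : ℕ → Bool) :
    walkDepth (n + 1) (stackCons false w) = walkDepth n w + 1 := rfl

@[simp] theorem upCount_succ_true (n : ℕ) (w : ℕ → Bool) :
    upCount (n + 1) (stackCons true w) = upCount n w + 1 := rfl

@[simp] theorem upCount_succ_false (n : ℕ) (w : ℕ → Bool) :
    upCount (n + 1) (stackCons false w) = upCount n w := rfl

theorem walkDepth_le (n : ℕ) (w : ℕ → Bool) : walkDepth n w ≤ n := by
  induction n generalizing w with
  | zero => rfl
  | succ n ih =>
    have := ih fun i => w (i + 1)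
    rw [walkDepth]; split_ifs <;> omega

theorem upCount_le (n : ℕ) (w : ℕ → Bool) : upCount n w ≤ n := by
  induction n generalizing w with
  | zero => rfl
  | succ n ih =>
    have := ih fun i => w (i + 1)
    rw [upCount]; split_ifs <;> omega

theorem walkDepth_le_succ (n : ℕ) (w : ℕ → Bool) : walkDepth n w ≤ walkDepth (n + 1) w := by
  induction n generalizing w with
  | zero => simp
  | succ n ih =>
    have := ih fun i => w (i + 1)
    rw [walkDepth, walkDepth]; split_ifs <;> omega

theorem measurable_walkDepth (n : ℕ) : Measurable (walkDepth n) := by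
  induction n with
  | zero => exact measurable_const
  | succ n ih =>
    have h : Measurable fun w : ℕ → Bool => walkDepth n fun i => w (i + 1) :=
      ih.comp (by fun_prop)
    refine Measurable.ite (measurableSet_eq_fun (measurable_pi_apply 0) measurable_const) ?_ ?_
    · exact h.sub_const 1
    · exact h.add_const 1

theorem measurable_upCount (n : ℕ) : Measurable (upCount n) := by
  induction n with
  | zero => exact measurable_const
  | succ n ih =>
    have h : Measurable fun w : ℕ → Bool => upCount n fun i => w (i + 1) :=
      ih.comp (by fun_prop)
    refine Measurable.ite (measurableSet_eq_fun (measurable_pi_apply 0) measurable_const) ?_ ?_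
    · exact h.add_const 1
    · exact h

theorem integrable_natCast_of_le {Ω : Type*} [MeasurableSpace Ω] {μ : Measure Ω}
    [IsFiniteMeasure μ] {f : Ω → ℕ} (hf : Measurable f) {n : ℕ} (h : ∀ x, f x ≤ n) :
    Integrable (fun x => (f x : ℝ)) μ := by
  refine Integrable.of_bound (C := n) (measurable_from_nat.comp hf).aestronglyMeasurable
    (ae_of_all _ fun x => ?_)
  simpa using h x

theorem integrable_walkDepth (n : ℕ) : Integrable (fun w => (walkDepth n w : ℝ)) coinMeasure :=
  integrable_natCast_of_le (measurable_walkDepth n) (walkDepth_le n)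

theorem integrable_upCount (n : ℕ) : Integrable (fun w => (upCount n w : ℝ)) coinMeasure :=
  integrable_natCast_of_le (measurable_upCount n) (upCount_le n)

theorem integral_upCount (n : ℕ) : ∫ w, (upCount n w : ℝ) ∂coinMeasure = n / 2 := by
  induction n with
  | zero => simp [upCount]
  | succ n ih =>
    rw [integral_coinMeasure (integrable_upCount _)]
    simp only [upCount_succ_true, upCount_succ_false, Nat.cast_add, Nat.cast_one]
    rw [integral_add (integrable_upCount n) (integrable_const _), ih]
    simp; ring

/-! ### The walk is almost surely unbounded below -/

/-- The walks which never go below `-K`. -/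
def boundedWalks (K : ℕ) : Set (ℕ → Bool) := {w | ∀ n, walkDepth n w ≤ K}

theorem measurableSet_boundedWalks (K : ℕ) : MeasurableSet (boundedWalks K) := by
  unfold boundedWalks
  rw [Set.ofPred_forall]
  exact .iInter fun n => measurableSet_le (measurable_walkDepth n) measurable_const

theorem stackCons_true_mem_boundedWalks (K : ℕ) (w : ℕ → Bool) :
    stackCons true w ∈ boundedWalks K ↔ w ∈ boundedWalks (K + 1) := by
  constructor
  · intro h n
    have := h (n + 1)
    rw [walkDepth_succ_true] at this; omega
  · intro h n
    cases n with
    | zero => simp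
    | succ n => have := h n; rw [walkDepth_succ_true]; omega

theorem stackCons_false_mem_boundedWalks_succ (K : ℕ) (w : ℕ → Bool) :
    stackCons false w ∈ boundedWalks (K + 1) ↔ w ∈ boundedWalks K := by
  constructor
  · intro h n
    have := h (n + 1)
    rw [walkDepth_succ_false] at this; omega
  · intro h n
    cases n with
    | zero => simp
    | succ n => have := h n; rw [walkDepth_succ_false]; omega

theorem stackCons_false_notMem_boundedWalks_zero (w : ℕ → Bool) :
    stackCons false w ∉ boundedWalks 0 := by
  intro h
  have := h 1
  simp at this

theorem measureReal_coinMeasure {B : Set (ℕ → Bool)} (hB : MeasurableSet B) :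
    coinMeasure.real B = (1 / 2) * coinMeasure.real {w | stackCons true w ∈ B} +
      (1 / 2) * coinMeasure.real {w | stackCons false w ∈ B} := by
  have h : ∀ b, MeasurableSet {w : ℕ → Bool | stackCons b w ∈ B} := fun b =>
    (measurable_stackCons.comp measurable_prodMk_left) hB
  have key := integral_coinMeasure (f := B.indicator 1)
    ((integrable_const (1 : ℝ)).indicator hB)
  rw [integral_indicator_one hB] at key
  rw [key, ← integral_indicator_one (h true), ← integral_indicator_one (h false)]
  rfl

/-- Gambler's ruin. Conditioning on the first step makes `q` discrete harmonic with boundary value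
zero at `-1`, so `q K = (K + 1) * q 0`; being bounded by one, it vanishes. -/
theorem coinMeasure_boundedWalks (K : ℕ) : coinMeasure (boundedWalks K) = 0 := by
  set q : ℕ → ℝ := fun K => coinMeasure.real (boundedWalks K) with hq
  have h0 : q 0 = (1 / 2) * q 1 := by
    rw [hq]; dsimp only
    rw [measureReal_coinMeasure (measurableSet_boundedWalks 0)]
    simp [stackCons_true_mem_boundedWalks, stackCons_false_notMem_boundedWalks_zero]
  have h1 : ∀ K, q (K + 1) = (1 / 2) * q (K + 2) + (1 / 2) * q K := by
    intro K
    rw [hq]; dsimp only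
    rw [measureReal_coinMeasure (measurableSet_boundedWalks (K + 1))]
    simp [stackCons_true_mem_boundedWalks, stackCons_false_mem_boundedWalks_succ]
  have h2 : ∀ K : ℕ, q K = (K + 1) * q 0 ∧ q (K + 1) = (K + 2) * q 0 := by
    intro K
    induction K with
    | zero => constructor <;> norm_num; linarith
    | succ K ih =>
      refine ⟨by rw [ih.2]; push_cast; ring, ?_⟩
      have := h1 K
      push_cast
      linarith [ih.1, ih.2]
  have h3 : q 0 = 0 := by
    by_contra hne
    have hpos : 0 < q 0 := lt_of_le_of_ne measureReal_nonneg (Ne.symm hne)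
    obtain ⟨n, hn⟩ := exists_nat_gt (1 / q 0)
    have h4 : q n ≤ 1 := measureReal_le_one
    rw [(h2 n).1] at h4
    rw [div_lt_iff₀ hpos] at hn
    linarith
  have h5 : q K = 0 := by rw [(h2 K).1, h3, mul_zero]
  exact (measureReal_eq_zero_iff (measure_ne_top _ _)).1 h5

theorem ae_exists_lt_walkDepth : ∀ᵐ w ∂coinMeasure, ∀ K : ℕ, ∃ n, K < walkDepth n w := by
  rw [ae_all_iff]
  intro K
  have := coinMeasure_boundedWalks K
  rw [ae_iff]
  convert this using 2
  ext w
  simp [boundedWalks]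

/-! ### Sublinear growth of the mean depth -/

/-- The changes `+1` and `-1` cancel on average, except at depth zero, where the truncated
subtraction loses nothing. -/
theorem integral_walkDepth_succ (n : ℕ) :
    ∫ w, (walkDepth (n + 1) w : ℝ) ∂coinMeasure = ∫ w, (walkDepth n w : ℝ) ∂coinMeasure +
      (1 / 2) * coinMeasure.real {w | walkDepth n w = 0} := by
  have hm : MeasurableSet {w | walkDepth n w = 0} :=
    measurableSet_eq_fun (measurable_walkDepth n) measurable_const
  rw [integral_coinMeasure (integrable_walkDepth _)]
  simp only [walkDepth_succ_true, walkDepth_succ_false]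
  rw [← integral_indicator_one hm]
  have e : ∀ w : ℕ → Bool, ((walkDepth n w - 1 : ℕ) : ℝ) =
      (walkDepth n w : ℝ) - 1 + ({w | walkDepth n w = 0} : Set (ℕ → Bool)).indicator 1 w := by
    intro w
    by_cases h : walkDepth n w = 0
    · rw [Set.indicator_of_mem (show w ∈ {w | walkDepth n w = 0} from h)]; simp [h]
    · rw [Set.indicator_of_notMem (show w ∉ {w | walkDepth n w = 0} from h),
        Nat.cast_sub (by omega)]
      simp
  have hi : Integrable (({w | walkDepth n w = 0} : Set (ℕ → Bool)).indicator (1 : (ℕ → Bool) → ℝ))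
    coinMeasure := (integrable_const (1 : ℝ)).indicator hm
  simp only [e, Nat.cast_add, Nat.cast_one]
  rw [integral_add (f := fun w => (walkDepth n w : ℝ) - 1)
      ((integrable_walkDepth n).sub (integrable_const _)) hi,
    integral_sub (integrable_walkDepth n) (integrable_const _),
    integral_add (integrable_walkDepth n) (integrable_const _)]
  simp; ring

/-- The increments of the mean are half the probability that the depth is still zero, which
decreases to half the probability of never going below the start, that is, to zero. The Cesàro means
follow. -/
theorem tendsto_integral_walkDepth_div :
    Tendsto (fun n : ℕ => (∫ w, (walkDepth n w : ℝ) ∂coinMeasure) / n) atTop (nhds 0) := by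
  have h1 : Tendsto (fun n => coinMeasure {w | walkDepth n w = 0}) atTop (nhds 0) := by
    have hanti : Antitone fun n => {w | walkDepth n w = 0} := by
      refine antitone_nat_of_succ_le fun n w hw => ?_
      have := walkDepth_le_succ n w
      have hw : walkDepth (n + 1) w = 0 := hw
      show walkDepth n w = 0
      omega
    have h := tendsto_measure_iInter_atTop (μ := coinMeasure)
      (fun n => (measurableSet_eq_fun (measurable_walkDepth n)
        measurable_const).nullMeasurableSet) hanti ⟨0, measure_ne_top _ _⟩
    have e : (⋂ n, {w | walkDepth n w = 0}) = boundedWalks 0 := by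
      ext w; simp [boundedWalks]
    rwa [e, coinMeasure_boundedWalks] at h
  have h2 : Tendsto (fun n => (1 / 2) * coinMeasure.real {w | walkDepth n w = 0}) atTop
      (nhds 0) := by
    have := ((ENNReal.tendsto_toReal ENNReal.zero_ne_top).comp h1).const_mul (1 / 2)
    simpa [measureReal_def] using this
  have h3 := h2.cesaro
  refine h3.congr fun n => ?_
  rw [div_eq_inv_mul (∫ w, (walkDepth n w : ℝ) ∂coinMeasure)]
  refine congrArg _ ?_
  clear h3
  induction n with
  | zero => simp
  | succ n ih => rw [Finset.sum_range_succ, ih, integral_walkDepth_succ]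

/-! ### Recurrence in both directions -/

/-- The path `f` has an arbitrary starting value, so that the induction can drop the first step. -/
theorem exists_lt_of_lt_walkDepth {n : ℕ} {w : ℕ → Bool} {K : ℕ} {f : ℕ → ℤ}
    (hf : ∀ k, f (k + 1) = f k + if w k then 1 else -1) (h : K < walkDepth n w) :
    ∃ k, f k < f 0 - K := by
  induction n generalizing w K f with
  | zero => simp at h
  | succ n ih =>
    have h0 := hf 0
    rw [walkDepth] at h
    split_ifs at h with hw
    · obtain ⟨k, hk⟩ := ih (K := K + 1) (f := fun k => f (k + 1)) (fun k => hf (k + 1))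
        (by omega)
      refine ⟨k + 1, ?_⟩
      simp only [hw, if_true, zero_add] at h0 hk
      push_cast at hk; omega
    · simp only [hw, zero_add] at h0
      cases K with
      | zero => exact ⟨1, by simp at h0 ⊢; omega⟩
      | succ K =>
        obtain ⟨k, hk⟩ := ih (K := K) (f := fun k => f (k + 1)) (fun k => hf (k + 1))
          (by omega)
        refine ⟨k + 1, ?_⟩
        simp only [zero_add] at h0 hk
        simp at h0
        push_cast; omega

theorem map_symmetricProduct_bool (r : ℤ) :
    (symmetricProduct Bool).map (fun z (i : ℕ) => z (r + i)) = coinMeasure :=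
  map_comp_infinitePi _ fun i j h => by simpa using h

/-- Read backwards from `-1`, the height goes up where `z` is `false`; with the symbols exchanged
the left half is again a fair walk. -/
theorem map_symmetricProduct_bool_neg :
    (symmetricProduct Bool).map (fun z (i : ℕ) => !z (-1 - i)) = coinMeasure := by
  have h1 : (symmetricProduct Bool).map (fun z (i : ℕ) => z (-1 - i)) = coinMeasure :=
    map_comp_infinitePi _ fun i j h => by simpa using h
  have h2 : coinMeasure.map (fun w i => !w i) = coinMeasure := by
    rw [coinMeasure, Measure.infinitePi_map_pi _ fun _ => measurable_of_finite _]
    congr 1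
    funext i
    refine Measure.ext_of_singleton fun b => ?_
    rw [Measure.map_apply (measurable_of_finite _) (measurableSet_singleton b)]
    have : (fun b => !b) ⁻¹' {b} = {!b} := by ext c; cases b <;> cases c <;> simp
    rw [this, uniformOn_univ_singleton, uniformOn_univ_singleton]
  have hm : Measurable fun (w : ℕ → Bool) i => !w i :=
    measurable_pi_lambda _ fun i => (measurable_of_finite not).comp (measurable_pi_apply i)
  rw [← h2, ← h1, Measure.map_map hm (by fun_prop)]
  rfl

instance {A : Type*} [MeasurableSpace A] [Finite A] [Nonempty A] [MeasurableSingletonClass A] :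
    IsProbabilityMeasure (symmetricProduct A) := by
  unfold symmetricProduct; infer_instance

theorem ae_mem_recurrentSet : ∀ᵐ z ∂symmetricProduct Bool, z ∈ recurrentSet := by
  have hm : Measurable fun (z : ℤ → Bool) (i : ℕ) => !z (-1 - i) :=
    measurable_pi_lambda _ fun i => (measurable_of_finite not).comp (measurable_pi_apply _)
  have hm₀ : Measurable fun (z : ℤ → Bool) (i : ℕ) => z (0 + i) := by fun_prop
  have h1 := ae_exists_lt_walkDepth
  rw [← map_symmetricProduct_bool 0] at h1
  have h2 := ae_exists_lt_walkDepth
  rw [← map_symmetricProduct_bool_neg] at h2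
  filter_upwards [ae_of_ae_map hm₀.aemeasurable h1, ae_of_ae_map hm.aemeasurable h2] with z hz hz'
  rw [mem_recurrentSet_iff]
  refine ⟨rightUnbounded_of_forall fun c => ?_, leftUnbounded_of_forall fun c => ?_⟩
  · obtain ⟨n, hn⟩ := hz c
    obtain ⟨k, hk⟩ := exists_lt_of_lt_walkDepth (f := fun k : ℕ => height z k)
      (fun k => by push_cast; rw [height_succ, zero_add]) hn
    exact ⟨k, by omega, by simpa [height_zero] using hk⟩
  · obtain ⟨n, hn⟩ := hz' c
    obtain ⟨k, hk⟩ := exists_lt_of_lt_walkDepth (f := fun k : ℕ => height z (-k))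
      (fun k => by
        have := height_succ z (-1 - k)
        rw [show (-1 - (k : ℤ)) + 1 = -k by ring] at this
        rw [this, show -((k + 1 : ℕ) : ℤ) = -1 - k by push_cast; ring]
        cases z (-1 - k) <;> simp) hn
    exact ⟨-k, by omega, by simpa [height_zero] using hk⟩

end RandomWalk

/-! ### Measurability -/

section Measurability

theorem measurable_height (i : ℤ) : Measurable fun z => height z i := by
  have h : ∀ j : ℤ, Measurable fun z : ℤ → Bool => if z j then (1 : ℤ) else -1 := fun j =>
    (measurable_of_finite fun b : Bool => if b then (1 : ℤ) else -1).comp (measurable_pi_apply j)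
  unfold height
  exact (Finset.measurable_fun_sum _ fun j _ => h j).sub (Finset.measurable_fun_sum _ fun j _ => h j)

theorem measurable_onesIndex (k : ℤ) : Measurable fun z => onesIndex z k := by
  have h : ∀ j : ℤ, Measurable fun z : ℤ → Bool => if z j then (1 : ℤ) else 0 := fun j =>
    (measurable_of_finite fun b : Bool => if b then (1 : ℤ) else 0).comp (measurable_pi_apply j)
  unfold onesIndex
  split_ifs
  · exact Finset.measurable_fun_sum _ fun j _ => h j
  · exact (Finset.measurable_fun_sum _ fun j _ => h j).neg

theorem measurableSet_recurrentSet : MeasurableSet recurrentSet := by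
  have e : recurrentSet = {z | RightUnbounded z ∧ LeftUnbounded z} := by
    ext z; exact mem_recurrentSet_iff
  have h : ∀ l c : ℤ, MeasurableSet {z | height z l ≤ c} := fun l c =>
    measurableSet_le (measurable_height l) measurable_const
  rw [e]
  unfold RightUnbounded LeftUnbounded
  simp only [measurableSet_setOfPred]
  refine Measurable.and (Measurable.forall fun r => Measurable.forall fun c =>
    Measurable.exists fun l => measurable_const.and (measurableSet_setOfPred.1 (h l c)))
    (Measurable.forall fun r => Measurable.forall fun c =>
      Measurable.exists fun l => measurable_const.and (measurableSet_setOfPred.1 (h l c)))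

theorem measurable_int_sSup {Ω : Type*} [MeasurableSpace Ω] {f : Ω → Set ℤ}
    (hf : ∀ l, MeasurableSet {w | l ∈ f w}) (hb : ∀ w, BddAbove (f w)) :
    Measurable fun w => sSup (f w) := by
  refine measurable_to_countable' fun l => ?_
  -- Either `l` is the greatest element, or the set is empty and `sSup` takes its default value `0`.
  have e : (fun w => sSup (f w)) ⁻¹' {l} =
      ({w | l ∈ f w} ∩ ⋂ l' ∈ Set.Ioi l, {w | l' ∈ f w}ᶜ) ∪
        ((⋂ l', {w | l' ∈ f w}ᶜ) ∩ {_w | l = 0}) := by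
    ext w
    simp only [Set.mem_preimage, Set.mem_singleton_iff, Set.mem_union, Set.mem_inter_iff,
      Set.mem_ofPred_eq, Set.mem_iInter, Set.mem_compl_iff, Set.mem_Ioi]
    constructor
    · rintro rfl
      rcases (f w).eq_empty_or_nonempty with h | h
      · right; simp [h]
      · exact Or.inl ⟨Int.csSup_mem h (hb w), fun l' hl' hmem =>
          absurd (le_csSup (hb w) hmem) (not_le.2 hl')⟩
    · rintro (⟨h1, h2⟩ | ⟨h1, rfl⟩)
      · exact IsGreatest.csSup_eq ⟨h1, fun l' hl' => not_lt.1 fun h => h2 l' h hl'⟩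
      · rw [Set.eq_empty_of_forall_notMem h1, Int.csSup_empty]
  rw [e]
  refine ((hf l).inter (.biInter (Set.to_countable _) fun l' _ => (hf l').compl)).union
    ((MeasurableSet.iInter fun l' => (hf l').compl).inter (.const _))

theorem measurable_openPos (r : ℤ) (i : ℕ) : Measurable fun z => openPos z r i := by
  refine measurable_int_sSup (fun l => ?_) fun z => ⟨r, fun l hl => hl.1.le⟩
  exact (MeasurableSet.const _).inter (measurableSet_le (measurable_height l)
    (((measurable_height r).sub_const 1).sub_const _))

theorem measurable_matchIndex (n : ℤ) : Measurable fun z => matchIndex z n := by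
  refine measurable_int_sSup (fun l => ?_) fun z => ⟨n, fun l hl => hl.1.le⟩
  exact (MeasurableSet.const _).inter (measurableSet_le (measurable_height l)
    (measurable_height _))

theorem measurable_apply_index {Ω A : Type*} [MeasurableSpace Ω] [MeasurableSpace A]
    {f : Ω → ℤ → A} {g : Ω → ℤ} (hf : ∀ k, Measurable fun w => f w k) (hg : Measurable g) :
    Measurable fun w => f w (g w) :=
  (measurable_from_prod_countable_left (f := fun p : Ω × ℤ => f p.1 p.2) hf).comp
    (measurable_id.prodMk hg)

variable {m : ℕ}

theorem measurable_dyckF : Measurable (dyckF (m := m)) := by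
  have h1 : ∀ k, Measurable fun p : (ℤ → Bool) × (ℤ → Fin m) => p.2 (onesIndex p.1 k) := fun k =>
    measurable_apply_index (f := fun p : (ℤ → Bool) × (ℤ → Fin m) => p.2)
      (fun k => (measurable_pi_apply k).comp measurable_snd)
      ((measurable_onesIndex k).comp measurable_fst)
  refine measurable_pi_lambda _ fun n => ?_
  refine Measurable.ite (measurableSet_eq_fun ((measurable_pi_apply n).comp measurable_fst)
    measurable_const) ?_ ?_
  · exact (measurable_of_finite DyckLetter.α).comp (h1 n)
  · exact (measurable_of_finite DyckLetter.β).comp (measurable_apply_index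
      (f := fun (p : (ℤ → Bool) × (ℤ → Fin m)) k => p.2 (onesIndex p.1 k)) h1
      ((measurable_matchIndex n).comp measurable_fst))

theorem measurable_openPattern : Measurable (openPattern (m := m)) :=
  measurable_pi_lambda _ fun n => (measurable_of_finite DyckLetter.isOpening).comp
    (measurable_pi_apply n)

/-- The sequences which agree with `y` on `[r, r + n)`. -/
def cylSet {A : Type*} (y : ℤ → A) (r : ℤ) (n : ℕ) : Set (ℤ → A) :=
  {x | blockList x r n = blockList y r n}

theorem mem_cylSet {A : Type*} {x y : ℤ → A} {r : ℤ} {n : ℕ} :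
    x ∈ cylSet y r n ↔ blockList x r n = blockList y r n := Iff.rfl

theorem measurableSet_blockList {A : Type*} [MeasurableSpace A] [DiscreteMeasurableSpace A]
    (r : ℤ) (n : ℕ) (w : List A) : MeasurableSet {x : ℤ → A | blockList x r n = w} := by
  by_cases h : ∃ y, blockList y r n = w
  · obtain ⟨y, rfl⟩ := h
    have e : {x : ℤ → A | blockList x r n = blockList y r n} =
        ⋂ k : ℤ, {x | r ≤ k → k < r + n → x k = y k} := by
      ext x; simp [blockList_eq_iff]
    rw [e]
    refine .iInter fun k => ?_
    by_cases h1 : r ≤ k ∧ k < r + n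
    · simp only [h1.1, h1.2, true_imp_iff]
      exact (measurable_pi_apply (X := fun _ : ℤ => A) k) (MeasurableSet.of_discrete (s := {y k}))
    · rw [not_and] at h1
      convert MeasurableSet.univ
      ext x
      simp only [Set.mem_ofPred_eq, Set.mem_univ, iff_true]
      exact fun h h' => absurd h' (h1 h)
  · convert MeasurableSet.empty
    ext x
    simp only [Set.mem_ofPred_eq, Set.mem_empty_iff_false, iff_false]
    exact fun hx => h ⟨x, hx⟩

theorem measurableSet_cylSet {A : Type*} [MeasurableSpace A] [DiscreteMeasurableSpace A]
    (y : ℤ → A) (r : ℤ) (n : ℕ) : MeasurableSet (cylSet y r n) :=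
  measurableSet_blockList r n _

theorem measurable_blockList_comp {A B : Type*} [MeasurableSpace A] [DiscreteMeasurableSpace A]
    [Countable A] [MeasurableSpace B] (r : ℤ) (n : ℕ) (f : List A → B) :
    Measurable fun x : ℤ → A => f (blockList x r n) := by
  let _ : MeasurableSpace (List A) := ⊤
  have h : Measurable fun x : ℤ → A => blockList x r n :=
    measurable_to_countable' fun w => measurableSet_blockList r n w
  exact (measurable_from_top (f := f)).comp h

theorem measurableSet_dyckShift : MeasurableSet (dyckShift m) := by
  have e : dyckShift m = ⋂ (r : ℤ) (n : ℕ), {x | block x r n ∈ dyckLanguage m} := by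
    ext x; simp [dyckShift]
  rw [e]
  refine .iInter fun r => .iInter fun n => ?_
  have := measurable_blockList_comp (A := DyckLetter m) r n
    fun w => FreeMonoid.ofList w ∈ dyckLanguage m
  simp only [← toList_block, FreeMonoid.ofList_toList] at this
  exact measurableSet_setOfPred.2 this

/-- Two finite measures which agree on large centred cylinders are equal. -/
theorem ext_of_cylSet {A : Type*} [MeasurableSpace A] [DiscreteMeasurableSpace A] [Finite A]
    [Nonempty A] {μ ν : Measure (ℤ → A)} [IsFiniteMeasure μ] [IsFiniteMeasure ν] (N : ℕ)
    (h : ∀ M ≥ N, ∀ y, μ (cylSet y (-M) (2 * M + 1)) = ν (cylSet y (-M) (2 * M + 1))) :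
    μ = ν := by
  -- Uniqueness of projective limits: every finite set of coordinates lies in some window `[-M, M]`
  -- with `M ≥ N`, and there the marginals agree on singletons.
  have key : IsProjectiveLimit μ fun I : Finset ℤ => ν.map I.restrict := by
    intro I
    obtain ⟨M, hM, hI⟩ : ∃ M ≥ N, ∀ k ∈ I, |k| ≤ M := by
      refine ⟨N + I.sup fun k => k.natAbs, by omega, fun k hk => ?_⟩
      have : k.natAbs ≤ I.sup fun k => k.natAbs := Finset.le_sup (f := fun k : ℤ => k.natAbs) hk
      rw [Int.abs_eq_natAbs]; exact_mod_cast this.trans (by omega)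
    set J : Finset ℤ := Finset.Ico (-M : ℤ) (-M + (2 * M + 1 : ℕ)) with hJ
    have hIJ : I ⊆ J := fun k hk => by
      have := abs_le.1 (hI k hk)
      rw [hJ, Finset.mem_Ico]; omega
    have hmap : μ.map J.restrict = ν.map J.restrict := by
      refine Measure.ext_of_singleton fun w => ?_
      rw [Measure.map_apply (by fun_prop) (measurableSet_singleton w),
        Measure.map_apply (by fun_prop) (measurableSet_singleton w)]
      obtain ⟨y, hy⟩ : ∃ y : ℤ → A, ∀ k (hk : k ∈ J), y k = w ⟨k, hk⟩ := by
        classical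
        exact ⟨fun k => if hk : k ∈ J then w ⟨k, hk⟩ else Classical.arbitrary A,
          fun k hk => dif_pos hk⟩
      have e : (J.restrict : (ℤ → A) → (J → A)) ⁻¹' {w} = cylSet y (-M) (2 * M + 1) := by
        ext x
        simp only [Set.mem_preimage, Set.mem_singleton_iff, funext_iff, Finset.restrict,
          mem_cylSet, blockList_eq_iff, Subtype.forall]
        constructor
        · intro hx k h1 h2
          have hk : k ∈ J := Finset.mem_Ico.2 ⟨h1, h2⟩
          rw [hx k hk, hy k hk]
        · intro hx k hk
          have := Finset.mem_Ico.1 hk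
          rw [hx k this.1 this.2, hy k hk]
      rw [e, h M hM]
    have e2 : (I.restrict : (ℤ → A) → (I → A)) = Finset.restrict₂ hIJ ∘ J.restrict := rfl
    dsimp only
    rw [e2, ← Measure.map_map (by fun_prop) (by fun_prop), hmap,
      Measure.map_map (by fun_prop) (by fun_prop)]
  have key' : IsProjectiveLimit ν fun I : Finset ℤ => ν.map I.restrict := fun I => rfl
  exact key.unique key'

end Measurability

/-! ### The measure of cylinders -/

section Cylinders

variable {m : ℕ}

/-- Once pattern and opening types are right, only the closing types remain. That the block of `y`
runs from the stack at `r` covers both kinds: brackets matched inside the block and brackets matched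
before it. -/
theorem blockList_bracketSeq_eq_iff {z : ℤ → Bool} (hz : LeftUnbounded z) (l : ℤ → Fin m)
    (y : ℤ → DyckLetter m) (r : ℤ) (n : ℕ) :
    blockList (bracketSeq z l) r n = blockList y r n ↔
      (∀ k, r ≤ k → k < r + n → z k = openPattern y k) ∧
      (∀ k, r ≤ k → k < r + n → openPattern y k = true → l k = (y k).label) ∧
      stackRun (blockList y r n) (stackAt z l r) ≠ none := by
  constructor
  · intro h
    have h' := blockList_eq_iff.1 h
    have h1 : ∀ k, r ≤ k → k < r + n → z k = openPattern y k := fun k hk hk' => by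
      have := congrArg DyckLetter.isOpening (h' k hk hk')
      rwa [show (bracketSeq z l k).isOpening = z k from congrFun (openPattern_bracketSeq z l) k]
        at this
    refine ⟨h1, fun k hk hk' ho => ?_, ?_⟩
    · have := h' k hk hk'
      rw [bracketSeq_of_true ((h1 k hk hk').trans ho)] at this
      rw [← this]; rfl
    · rw [← h, stackRun_bracketSeq hz]; simp
  · induction n generalizing r with
    | zero => intro _; rfl
    | succ n ih =>
      rintro ⟨h1, h2, h3⟩
      have hr : z r = openPattern y r := h1 r le_rfl (by push_cast; omega)
      rw [blockList_succ, blockList_succ]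
      rw [blockList_succ] at h3
      have ih' := fun h3 => ih (r + 1) ⟨fun k hk hk' => h1 k (by omega) (by push_cast; omega),
        fun k hk hk' => h2 k (by omega) (by push_cast; omega), h3⟩
      cases hy : y r with
      | α j =>
        have ho : openPattern y r = true := by simp [openPattern, hy, DyckLetter.isOpening]
        have hl : l r = j := by rw [h2 r le_rfl (by push_cast; omega) ho, hy]; rfl
        rw [hy, stackRun_cons_α, ← hl, ← stackAt_succ_of_true hz l (hr.trans ho)] at h3
        rw [ih' h3, bracketSeq_of_true (hr.trans ho), hl]
      | β j =>
        have ho : openPattern y r = false := by simp [openPattern, hy, DyckLetter.isOpening]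
        rw [hy, stackRun_cons_β, ← stackAt_succ_of_false hz l (hr.trans ho)] at h3
        by_cases hc : stackAt z l r 0 = j
        · rw [if_pos hc] at h3
          rw [ih' h3, bracketSeq_of_false (hr.trans ho), ← hc]; rfl
        · rw [if_neg hc] at h3; exact absurd rfl h3

theorem card_openPattern (y : ℤ → DyckLetter m) (r : ℤ) (n : ℕ) :
    Fintype.card {k : Fin n // openPattern y (r + (k : ℕ)) = true} =
      openingCount (blockList y r n) := by
  rw [Fintype.card_subtype, Finset.card_filter]
  induction n generalizing r with
  | zero => simp [blockList_zero, openingCount]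
  | succ n ih =>
    rw [Fin.sum_univ_succ, blockList_succ]
    have := ih (r + 1)
    have e : ∀ k : Fin n, r + ((k.succ : Fin (n + 1)) : ℕ) = r + 1 + ((k : ℕ) : ℤ) := fun k => by
      simp; ring
    simp only [e, this]
    cases hy : y r <;>
      simp [openPattern, hy, DyckLetter.isOpening, openingCount, add_comm]

/-- The mass of a cylinder given by a word of the Dyck language. -/
noncomputable def cylWeight (w : List (DyckLetter m)) : ENNReal :=
  (2 : ENNReal)⁻¹ ^ w.length * (m : ENNReal)⁻¹ ^ (openingCount w + unmatchedCount w)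

/-- The fibre is a box: `a` is prescribed once for each opening bracket in the block, by its type,
and once for each of the top open brackets at time `r`, by the domain of the word. The former lie at
or after `r` and the latter before it, so all coordinates are distinct. -/
theorem symmetricProduct_fiber [NeZero m] {z : ℤ → Bool} (hz : LeftUnbounded z) (y : ℤ → DyckLetter m)
    (r : ℤ) (n : ℕ) (hy : block y r n ∈ dyckLanguage m)
    (hzy : ∀ k, r ≤ k → k < r + n → z k = openPattern y k) :
    symmetricProduct (Fin m) {a | dyckF (z, a) ∈ cylSet y r n} =
      (m : ENNReal)⁻¹ ^ (openingCount (blockList y r n) + unmatchedCount (blockList y r n)) := by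
  obtain ⟨b, hb⟩ : ∃ b : ℕ → Fin m, ∀ s, stackRun (blockList y r n) s ≠ none ↔
      ∀ i < unmatchedCount (blockList y r n), s i = b i := by
    rcases stackRun_domain (blockList y r n) with h | h
    · obtain ⟨s, hs⟩ := mem_dyckLanguage_iff.1 hy
      exact absurd (h s) (by rwa [toList_block] at hs)
    · exact h
  set f : {k : Fin n // openPattern y (r + (k : ℕ)) = true} ⊕
      Fin (unmatchedCount (blockList y r n)) → ℤ :=
    Sum.elim (fun k => onesIndex z (r + ((k : Fin n) : ℕ)))
      (fun i => onesIndex z (openPos z r i)) with hf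
  set c : {k : Fin n // openPattern y (r + (k : ℕ)) = true} ⊕
      Fin (unmatchedCount (blockList y r n)) → Fin m :=
    Sum.elim (fun k => (y (r + ((k : Fin n) : ℕ))).label) (fun i => b i) with hc
  have hz1 : ∀ k : {k : Fin n // openPattern y (r + (k : ℕ)) = true},
      z (r + ((k : Fin n) : ℕ)) = true := fun k => by
    rw [hzy _ (by omega) (by have := k.1.2; omega)]; exact k.2
  have hinj : Function.Injective f := by
    rintro (k | i) (k' | i') h
    · have h' := onesIndex_injOn z (hz1 k) (hz1 k') h
      have : (k : Fin n) = k' := Fin.ext (by omega)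
      exact congrArg _ (Subtype.ext this)
    · have h' := onesIndex_injOn z (hz1 k) (apply_openPos hz r i') h
      have := openPos_lt hz r i'
      omega
    · have h' := onesIndex_injOn z (apply_openPos hz r i) (hz1 k') h
      have := openPos_lt hz r i
      omega
    · have h' := onesIndex_injOn z (apply_openPos hz r i) (apply_openPos hz r i') h
      exact congrArg _ (Fin.ext (openPos_injective hz r h'))
  have e : {a : ℤ → Fin m | dyckF (z, a) ∈ cylSet y r n} = {a | ∀ k, a (f k) = c k} := by
    ext a
    rw [Set.mem_ofPred_eq, Set.mem_ofPred_eq, mem_cylSet, dyckF_eq_bracketSeq,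
      blockList_bracketSeq_eq_iff hz, hb, Sum.forall]
    simp only [hf, hc, Sum.elim_inl, Sum.elim_inr]
    constructor
    · rintro ⟨-, h2, h3⟩
      exact ⟨fun k => h2 _ (by omega) (by have := k.1.2; omega) k.2, fun i => h3 i i.2⟩
    · rintro ⟨h2, h3⟩
      refine ⟨hzy, fun k hk hk' ho => ?_, fun i hi => h3 ⟨i, hi⟩⟩
      obtain ⟨i, rfl⟩ := Int.le.dest hk
      exact h2 ⟨⟨i, by omega⟩, ho⟩
  rw [e, symmetricProduct_box hinj]
  simp [card_openPattern]

theorem muFull_eq_map [NeZero m] : muFull m =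
    ((symmetricProduct Bool).prod (symmetricProduct (Fin m))).map dyckF := by
  rw [muFull, Measure.restrict_eq_self_of_ae_mem]
  have h := (Measure.quasiMeasurePreserving_fst (μ := symmetricProduct Bool)
    (ν := symmetricProduct (Fin m))).ae ae_mem_recurrentSet
  filter_upwards [h] with p hp
  exact ⟨hp, trivial⟩

-- Fubini: the pattern of `z` contributes `2⁻ⁿ`, and the fibres over it have constant mass. The
-- result sees the word only through its length, opening count and unmatched count.
open Classical in
theorem muFull_cylSet [NeZero m] (y : ℤ → DyckLetter m) (r : ℤ) (n : ℕ) :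
    muFull m (cylSet y r n) =
      if block y r n ∈ dyckLanguage m then cylWeight (blockList y r n) else 0 := by
  have hms : MeasurableSet (dyckF (m := m) ⁻¹' cylSet y r n) :=
    measurable_dyckF (measurableSet_cylSet y r n)
  rw [muFull_eq_map, Measure.map_apply measurable_dyckF (measurableSet_cylSet y r n),
    Measure.prod_apply hms]
  split_ifs with hy
  · set B : Set (ℤ → Bool) := {z | ∀ k : Fin n, z (r + (k : ℕ)) = openPattern y (r + (k : ℕ))}
      with hB
    have hBm : MeasurableSet B := by
      rw [hB, Set.ofPred_forall]
      exact .iInter fun k => measurableSet_eq_fun (measurable_pi_apply _) measurable_const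
    have hBmem : ∀ z, z ∈ B ↔ ∀ k, r ≤ k → k < r + n → z k = openPattern y k := by
      intro z
      constructor
      · intro h k hk hk'
        obtain ⟨i, rfl⟩ := Int.le.dest hk
        exact h ⟨i, by omega⟩
      · intro h k
        exact h _ (by omega) (by have := k.2; omega)
    have hB2 : symmetricProduct Bool B = (2 : ENNReal)⁻¹ ^ n := by
      have := symmetricProduct_box (A := Bool) (f := fun k : Fin n => r + ((k : ℕ) : ℤ))
        (fun i j h => Fin.ext (by simpa using h)) (fun k => openPattern y (r + (k : ℕ)))
      simpa using this
    have key : ∀ᵐ z ∂symmetricProduct Bool,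
        symmetricProduct (Fin m) (Prod.mk z ⁻¹' (dyckF ⁻¹' cylSet y r n)) =
        B.indicator (fun _ => (m : ENNReal)⁻¹ ^
          (openingCount (blockList y r n) + unmatchedCount (blockList y r n))) z := by
      filter_upwards [ae_mem_recurrentSet] with z hz
      have hz := (mem_recurrentSet_iff.1 hz).2
      by_cases hzB : z ∈ B
      · rw [Set.indicator_of_mem hzB]
        exact symmetricProduct_fiber hz y r n hy ((hBmem z).1 hzB)
      · rw [Set.indicator_of_notMem hzB]
        convert measure_empty (μ := symmetricProduct (Fin m))
        ext a
        simp only [Set.mem_preimage, Set.mem_empty_iff_false, iff_false, mem_cylSet,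
          dyckF_eq_bracketSeq, blockList_bracketSeq_eq_iff hz]
        exact fun h => hzB ((hBmem z).2 h.1)
    rw [lintegral_congr_ae key, lintegral_indicator_const hBm, hB2, cylWeight, length_blockList,
      mul_comm]
  · rw [lintegral_eq_zero_iff (measurable_measure_prodMk_left hms)]
    filter_upwards [ae_mem_recurrentSet] with z hz
    have hz := (mem_recurrentSet_iff.1 hz).2
    rw [Pi.zero_apply]
    convert measure_empty (μ := symmetricProduct (Fin m))
    ext a
    simp only [Set.mem_preimage, Set.mem_empty_iff_false, iff_false, mem_cylSet,
      dyckF_eq_bracketSeq, blockList_bracketSeq_eq_iff hz]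
    exact fun h => hy (mem_dyckLanguage_iff.2 ⟨_, by rw [toList_block]; exact h.2.2⟩)

instance [NeZero m] : Nonempty (DyckLetter m) := ⟨.α 0⟩

instance [NeZero m] : IsProbabilityMeasure (muFull m) := by
  rw [muFull_eq_map]
  exact Measure.isProbabilityMeasure_map measurable_dyckF.aemeasurable

theorem ae_muFull_of_forall [NeZero m] {p : (ℤ → DyckLetter m) → Prop} (hp : MeasurableSet {x | p x})
    (h : ∀ᵐ q ∂(symmetricProduct Bool).prod (symmetricProduct (Fin m)), p (dyckF q)) :
    ∀ᵐ x ∂muFull m, p x := by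
  rw [muFull_eq_map]
  exact (ae_map_iff measurable_dyckF.aemeasurable hp).2 h

theorem ae_prod_recurrentSet [NeZero m] :
    ∀ᵐ q ∂(symmetricProduct Bool).prod (symmetricProduct (Fin m)), q.1 ∈ recurrentSet :=
  (Measure.quasiMeasurePreserving_fst (μ := symmetricProduct Bool)
    (ν := symmetricProduct (Fin m))).ae ae_mem_recurrentSet

theorem ae_mem_dyckShift [NeZero m] : ∀ᵐ x ∂muFull m, x ∈ dyckShift m := by
  refine ae_muFull_of_forall measurableSet_dyckShift ?_
  filter_upwards [ae_prod_recurrentSet] with q hq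
  exact bracketSeq_mem_dyckShift (mem_recurrentSet_iff.1 hq).2 _

/-! ### Shift invariance, and passage to the Dyck shift -/

/-- The mass of a cylinder depends on its word and not on its position. -/
theorem muFull_map_shift [NeZero m] : (muFull m).map (fun x n => x (n + 1)) = muFull m := by
  have hm : Measurable fun (x : ℤ → DyckLetter m) (n : ℤ) => x (n + 1) := by fun_prop
  have := Measure.isProbabilityMeasure_map (μ := muFull m) hm.aemeasurable
  refine ext_of_cylSet 0 fun M _ y => ?_
  have hb : ∀ (x : ℤ → DyckLetter m) (r : ℤ) (n : ℕ),
      blockList (fun k => x (k + 1)) r n = blockList x (r + 1) n := fun x r n => by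
    unfold blockList
    exact List.map_congr_left fun i _ => congrArg x (by ring)
  set y' : ℤ → DyckLetter m := fun k => y (k - 1) with hy'
  have hy : y = fun k => y' (k + 1) := by funext k; simp [hy']
  have e : (fun (x : ℤ → DyckLetter m) (n : ℤ) => x (n + 1)) ⁻¹' cylSet y (-M) (2 * M + 1) =
      cylSet y' (-M + 1) (2 * M + 1) := by
    ext x
    rw [Set.mem_preimage, mem_cylSet, mem_cylSet, hb, hy, hb]
  have e2 : block y' (-M + 1 : ℤ) (2 * M + 1) = block y (-M) (2 * M + 1) := by
    apply FreeMonoid.toList.injective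
    rw [toList_block, toList_block, hy, hb]
  have e3 : blockList y' (-M + 1 : ℤ) (2 * M + 1) = blockList y (-M) (2 * M + 1) := by
    rw [hy, hb]
  classical
  rw [Measure.map_apply hm (measurableSet_cylSet y _ _), e, muFull_cylSet, muFull_cylSet, e2, e3]

theorem muTilde_apply (B : Set (dyckShift m)) : muTilde m B = muFull m (Subtype.val '' B) :=
  (MeasurableEmbedding.subtype_coe measurableSet_dyckShift).comap_apply _ _

theorem map_val_muTilde [NeZero m] : (muTilde m).map Subtype.val = muFull m := by
  rw [muTilde, (MeasurableEmbedding.subtype_coe measurableSet_dyckShift).map_comap,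
    Subtype.range_coe, Measure.restrict_eq_self_of_ae_mem ae_mem_dyckShift]

instance [NeZero m] : IsProbabilityMeasure (muTilde m) := by
  constructor
  have := congrArg (fun μ => μ Set.univ) (map_val_muTilde (m := m))
  simpa [Measure.map_apply measurable_subtype_coe] using this

theorem measurable_dyckT : Measurable (dyckT m) := by
  refine Measurable.subtype_mk (measurable_pi_lambda _ fun n => ?_)
  exact (measurable_pi_apply (n + 1)).comp measurable_subtype_coe

theorem measurePreserving_dyckT [NeZero m] : MeasurePreserving (dyckT m) (muTilde m) (muTilde m) := by
  refine ⟨measurable_dyckT, ?_⟩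
  have hemb := MeasurableEmbedding.subtype_coe (measurableSet_dyckShift (m := m))
  rw [← hemb.comap_map ((muTilde m).map (dyckT m)), Measure.map_map measurable_subtype_coe
    measurable_dyckT]
  have e : (Subtype.val ∘ dyckT m : dyckShift m → ℤ → DyckLetter m) =
      (fun x n => x (n + 1)) ∘ Subtype.val := rfl
  rw [e, ← Measure.map_map (by fun_prop) measurable_subtype_coe, map_val_muTilde,
    muFull_map_shift, muTilde]

end Cylinders

/-! ### Words with the same action -/

section SameAction

variable {m : ℕ}

/-- The words act in the same way on stacks and have the same number of opening brackets. -/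
def SameAction (u v : List (DyckLetter m)) : Prop :=
  (∀ s, stackRun u s = stackRun v s) ∧ openingCount u = openingCount v

theorem SameAction.symm {u v : List (DyckLetter m)} (h : SameAction u v) : SameAction v u :=
  ⟨fun s => (h.1 s).symm, h.2.symm⟩

theorem SameAction.append {u v : List (DyckLetter m)} (h : SameAction u v)
    (p q : List (DyckLetter m)) : SameAction (p ++ (u ++ q)) (p ++ (v ++ q)) := by
  refine ⟨fun s => ?_, by simp only [openingCount_append, h.2]⟩
  rw [stackRun_append, stackRun_append]
  congr 1
  funext s
  rw [stackRun_append, stackRun_append, h.1]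

/-- Membership in the language and the unmatched count are determined by the action, and the opening
count agrees by assumption. -/
theorem SameAction.muFull_cylSet_eq (hm : 2 ≤ m) {y y' : ℤ → DyckLetter m} {r : ℤ} {n : ℕ}
    (h : SameAction (blockList y r n) (blockList y' r n)) :
    muFull m (cylSet y r n) = muFull m (cylSet y' r n) := by
  classical
  have : NeZero m := ⟨by omega⟩
  have hL : block y r n ∈ dyckLanguage m ↔ block y' r n ∈ dyckLanguage m := by
    simp only [mem_dyckLanguage_iff, toList_block, h.1]
  rw [muFull_cylSet, muFull_cylSet]
  by_cases hy : block y r n ∈ dyckLanguage m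
  · rw [if_pos hy, if_pos (hL.1 hy), cylWeight, cylWeight, h.2, length_blockList,
      length_blockList, unmatchedCount_eq_of_stackRun_eq hm h.1]
    have := mem_dyckLanguage_iff.1 hy
    rwa [toList_block] at this
  · rw [if_neg hy, if_neg fun h => hy (hL.2 h)]

/-- Replace the block on `[r, r + n)` by that of `y`. -/
def replaceBlock {A : Type*} (y : ℤ → A) (r : ℤ) (n : ℕ) (x : ℤ → A) (k : ℤ) : A :=
  if r ≤ k ∧ k < r + n then y k else x k

theorem replaceBlock_of_mem {A : Type*} {y x : ℤ → A} {r : ℤ} {n : ℕ} {k : ℤ}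
    (h : r ≤ k ∧ k < r + n) : replaceBlock y r n x k = y k := if_pos h

theorem replaceBlock_of_notMem {A : Type*} {y x : ℤ → A} {r : ℤ} {n : ℕ} {k : ℤ}
    (h : ¬ (r ≤ k ∧ k < r + n)) : replaceBlock y r n x k = x k := if_neg h

theorem measurable_replaceBlock {A : Type*} [MeasurableSpace A] (y : ℤ → A) (r : ℤ) (n : ℕ) :
    Measurable (replaceBlock y r n) := by
  refine measurable_pi_lambda _ fun k => ?_
  unfold replaceBlock
  split_ifs
  · exact measurable_const
  · exact measurable_pi_apply k

theorem blockList_centred {A : Type*} (x : ℤ → A) {M N : ℕ} (h : N ≤ M) :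
    blockList x (-M) (2 * M + 1) = blockList x (-M) (M - N) ++
      (blockList x (-N) (2 * N + 1) ++ blockList x (N + 1) (M - N)) := by
  rw [show 2 * M + 1 = (M - N) + ((2 * N + 1) + (M - N)) by omega, blockList_add, blockList_add,
    show (-M : ℤ) + (M - N : ℕ) = -N by omega, show (-N : ℤ) + (2 * N + 1 : ℕ) = N + 1 by omega]

/-- On a larger centred window the replacement turns a word `p u q` into `p v q`, and acting alike
survives any context, so corresponding cylinders have equal mass. -/
theorem map_replaceBlock_muFull (hm : 2 ≤ m) {y y' : ℤ → DyckLetter m} {N : ℕ}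
    (h : SameAction (blockList y (-N) (2 * N + 1)) (blockList y' (-N) (2 * N + 1))) :
    ((muFull m).restrict (cylSet y (-N) (2 * N + 1))).map (replaceBlock y' (-N) (2 * N + 1)) =
      (muFull m).restrict (cylSet y' (-N) (2 * N + 1)) := by
  have : NeZero m := ⟨by omega⟩
  refine ext_of_cylSet N fun M hM v => ?_
  have hrm := measurable_replaceBlock y' (-N) (2 * N + 1)
  have hcm := measurableSet_cylSet v (-M) (2 * M + 1)
  rw [Measure.map_apply hrm hcm, Measure.restrict_apply (hrm hcm), Measure.restrict_apply hcm]
  by_cases hv : blockList v (-N) (2 * N + 1) = blockList y' (-N) (2 * N + 1)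
  · have hv' := blockList_eq_iff.1 hv
    set v' := replaceBlock y (-N) (2 * N + 1) v with hv'def
    have e1 : replaceBlock y' (-N) (2 * N + 1) ⁻¹' cylSet v (-M) (2 * M + 1) ∩
        cylSet y (-N) (2 * N + 1) = cylSet v' (-M) (2 * M + 1) := by
      ext x
      simp only [Set.mem_inter_iff, Set.mem_preimage, mem_cylSet, blockList_eq_iff]
      constructor
      · rintro ⟨h1, h2⟩ k hk hk'
        by_cases hkN : (-N : ℤ) ≤ k ∧ k < -N + (2 * N + 1 : ℕ)
        · rw [hv'def, replaceBlock_of_mem hkN, h2 k hkN.1 hkN.2]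
        · have := h1 k hk hk'
          rwa [replaceBlock_of_notMem hkN, ← replaceBlock_of_notMem (y := y) (x := v) hkN] at this
      · intro h1
        refine ⟨fun k hk hk' => ?_, fun k hk hk' => ?_⟩
        · by_cases hkN : (-N : ℤ) ≤ k ∧ k < -N + (2 * N + 1 : ℕ)
          · rw [replaceBlock_of_mem hkN, hv' k hkN.1 hkN.2]
          · rw [replaceBlock_of_notMem hkN, h1 k hk hk', hv'def, replaceBlock_of_notMem hkN]
        · rw [h1 k (by omega) (by push_cast at hk' ⊢; omega), hv'def, replaceBlock_of_mem ⟨hk, hk'⟩]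
    have e2 : cylSet v (-M) (2 * M + 1) ∩ cylSet y' (-N) (2 * N + 1) =
        cylSet v (-M) (2 * M + 1) := by
      refine Set.inter_eq_left.2 fun x hx => ?_
      rw [mem_cylSet, blockList_eq_iff] at hx ⊢
      intro k hk hk'
      rw [hx k (by omega) (by push_cast at hk' ⊢; omega), hv' k hk hk']
    rw [e1, e2]
    refine SameAction.muFull_cylSet_eq hm ?_
    rw [blockList_centred v' hM, blockList_centred v hM, hv]
    have e3 : blockList v' (-N) (2 * N + 1) = blockList y (-N) (2 * N + 1) :=
      blockList_eq_iff.2 fun k hk hk' => replaceBlock_of_mem ⟨hk, hk'⟩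
    have e4 : blockList v' (-M) (M - N) = blockList v (-M) (M - N) :=
      blockList_eq_iff.2 fun k hk hk' => replaceBlock_of_notMem (by omega)
    have e5 : blockList v' (N + 1) (M - N) = blockList v (N + 1) (M - N) :=
      blockList_eq_iff.2 fun k hk hk' => replaceBlock_of_notMem (by push_cast; omega)
    rw [e3, e4, e5]
    exact h.append _ _
  · have e1 : replaceBlock y' (-N) (2 * N + 1) ⁻¹' cylSet v (-M) (2 * M + 1) ∩
        cylSet y (-N) (2 * N + 1) = ∅ := by
      refine Set.eq_empty_of_forall_notMem fun x hx => hv ?_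
      have hx := hx.1
      rw [Set.mem_preimage, mem_cylSet, blockList_eq_iff] at hx
      refine blockList_eq_iff.2 fun k hk hk' => ?_
      rw [← hx k (by omega) (by push_cast at hk' ⊢; omega), replaceBlock_of_mem ⟨hk, hk'⟩]
    have e2 : cylSet v (-M) (2 * M + 1) ∩ cylSet y' (-N) (2 * N + 1) = ∅ := by
      refine Set.eq_empty_of_forall_notMem fun x hx => hv ?_
      obtain ⟨hx1, hx2⟩ := hx
      rw [mem_cylSet, blockList_eq_iff] at hx1 hx2
      refine blockList_eq_iff.2 fun k hk hk' => ?_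
      rw [← hx1 k (by omega) (by push_cast at hk' ⊢; omega), hx2 k hk hk']
    rw [e1, e2]

end SameAction

/-! ### Generic points -/

section Generic

variable {m : ℕ}

/-- The height is unbounded below in both directions, and no stack is eventually periodic. -/
def IsGeneric (x : ℤ → DyckLetter m) : Prop :=
  openPattern x ∈ recurrentSet ∧ ∀ (r : ℤ) (d i₀ : ℕ), 0 < d → ∃ i ≥ i₀,
    stackAt (openPattern x) (fun k => (x k).label) r (i + d) ≠
      stackAt (openPattern x) (fun k => (x k).label) r i

theorem measurableSet_isGeneric : MeasurableSet {x : ℤ → DyckLetter m | IsGeneric x} := by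
  have hs : ∀ r i, Measurable fun x : ℤ → DyckLetter m =>
      stackAt (openPattern x) (fun k => (x k).label) r i := fun r i =>
    measurable_apply_index (f := fun (x : ℤ → DyckLetter m) k => (x k).label)
      (fun k => (measurable_of_finite DyckLetter.label).comp (measurable_pi_apply k))
      ((measurable_openPos r i).comp measurable_openPattern)
  refine (measurable_openPattern measurableSet_recurrentSet).inter ?_
  refine measurableSet_setOfPred.2 (Measurable.forall fun r => Measurable.forall fun d =>
    Measurable.forall fun i₀ => Measurable.imp measurable_const (Measurable.exists fun i =>
      measurable_const.and ?_))
  exact measurableSet_setOfPred.1 (measurableSet_eq_fun (hs r (i + d)) (hs r i)).compl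

/-- Periodicity makes `a` constant along `f (i₀ + k * d)`. For the first `K + 1` values of `k` these
are independent coordinates, so the probability is at most `m * m⁻⁽ᴷ⁺¹⁾`, for every `K`. -/
theorem symmetricProduct_periodic (hm : 2 ≤ m) {f : ℕ → ℤ} (hf : Function.Injective f) {d : ℕ}
    (hd : 0 < d) (i₀ : ℕ) :
    symmetricProduct (Fin m) {a | ∀ i ≥ i₀, a (f (i + d)) = a (f i)} = 0 := by
  have : NeZero m := ⟨by omega⟩
  have key : ∀ K : ℕ, symmetricProduct (Fin m) {a | ∀ i ≥ i₀, a (f (i + d)) = a (f i)} ≤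
      (m : ENNReal)⁻¹ ^ K := by
    intro K
    have hsub : {a : ℤ → Fin m | ∀ i ≥ i₀, a (f (i + d)) = a (f i)} ⊆
        ⋃ c : Fin m, {a | ∀ k : Fin (K + 1), a (f (i₀ + k * d)) = c} := by
      intro a ha
      refine Set.mem_iUnion.2 ⟨a (f i₀), ?_⟩
      have : ∀ k : ℕ, a (f (i₀ + k * d)) = a (f i₀) := by
        intro k
        induction k with
        | zero => simp
        | succ k ih =>
          rw [show i₀ + (k + 1) * d = (i₀ + k * d) + d by ring, ha _ (by omega), ih]
      exact fun k => this k
    refine (measure_mono hsub).trans ((measure_iUnion_le _).trans ?_)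
    rw [tsum_fintype]
    have : ∀ c : Fin m, symmetricProduct (Fin m)
        {a | ∀ k : Fin (K + 1), a (f (i₀ + k * d)) = c} = (m : ENNReal)⁻¹ ^ (K + 1) := by
      intro c
      have hinj : Function.Injective fun k : Fin (K + 1) => f (i₀ + k * d) := by
        intro k k' h
        have h1 := hf h
        exact Fin.ext (Nat.eq_of_mul_eq_mul_right hd (by omega))
      have := symmetricProduct_box hinj fun _ => c
      simpa using this
    simp only [this, Finset.sum_const, Finset.card_univ, Fintype.card_fin, nsmul_eq_mul]
    rw [pow_succ', ← mul_assoc, ENNReal.mul_inv_cancel (by simp; omega) (by simp), one_mul]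
  have hlt : (m : ENNReal)⁻¹ < 1 := by
    rw [ENNReal.inv_lt_one]; exact_mod_cast hm
  have := ge_of_tendsto' (ENNReal.tendsto_pow_atTop_nhds_zero_of_lt_one hlt) key
  exact le_antisymm this bot_le

/-- For fixed `z` the entries of a stack are distinct coordinates of `a`, and there are countably
many triples `r`, `d`, `i₀`. -/
theorem ae_isGeneric (hm : 2 ≤ m) : ∀ᵐ x ∂muFull m, IsGeneric x := by
  have : NeZero m := ⟨by omega⟩
  refine ae_muFull_of_forall measurableSet_isGeneric ?_
  refine (Measure.ae_prod_iff_ae_ae (p := fun q => IsGeneric (dyckF q))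
    (measurable_dyckF measurableSet_isGeneric)).2 ?_
  filter_upwards [ae_mem_recurrentSet] with z hz
  have hl := (mem_recurrentSet_iff.1 hz).2
  have h : ∀ᵐ a ∂symmetricProduct (Fin m), ∀ (r : ℤ) (d i₀ : ℕ), 0 < d → ∃ i ≥ i₀,
      a (onesIndex z (openPos z r (i + d))) ≠ a (onesIndex z (openPos z r i)) := by
    rw [ae_all_iff]; intro r
    rw [ae_all_iff]; intro d
    rw [ae_all_iff]; intro i₀
    by_cases hd : 0 < d
    · have hinj : Function.Injective fun i => onesIndex z (openPos z r i) := fun i j h =>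
        openPos_injective hl r (onesIndex_injOn z (apply_openPos hl r i) (apply_openPos hl r j) h)
      have := symmetricProduct_periodic hm hinj hd i₀
      rw [← compl_compl {a : ℤ → Fin m | _}] at this
      filter_upwards [mem_ae_iff.2 this] with a ha _
      simpa using ha
    · exact ae_of_all _ fun a h => absurd h hd
  filter_upwards [h] with a ha
  have hs : ∀ r i, stackAt (openPattern (dyckF (z, a))) (fun k => (dyckF (z, a) k).label) r i =
      a (onesIndex z (openPos z r i)) := by
    intro r i
    rw [dyckF_eq_bracketSeq, openPattern_bracketSeq, stackAt,
      bracketSeq_of_true (apply_openPos hl r i)]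
    rfl
  refine ⟨by rw [dyckF_eq_bracketSeq, openPattern_bracketSeq]; exact hz, fun r d i₀ hd => ?_⟩
  simp only [hs]
  exact ha r d i₀ hd

/-- The blocks of two homoclinic points are at first only known to send one particular stack `σ` to
one particular stack `s`. Genericity makes their heights equal, and a long left margin forces the
top of `σ` onto every stack that survives it. -/
theorem exists_sameAction (hm : 2 ≤ m) {x y : dyckShift m} (hx : IsGeneric x.1)
    (hxy : DoubleTail x y) :
    ∃ N : ℕ, (∀ k : ℤ, (N : ℤ) < |k| → x.1 k = y.1 k) ∧
      SameAction (blockList x.1 (-N) (2 * N + 1)) (blockList y.1 (-N) (2 * N + 1)) := by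
  have : NeZero m := ⟨by omega⟩
  obtain ⟨n, hn⟩ := hxy
  obtain ⟨x, hxX⟩ := x
  obtain ⟨y, hyX⟩ := y
  dsimp only at hx hn ⊢
  have hleft : ∀ k < (-n : ℤ), x k = y k := fun k hk =>
    hn k (by rw [abs_of_nonpos (by omega)]; omega)
  have hright : ∀ k, (n + 1 : ℤ) ≤ k → x k = y k := fun k hk =>
    hn k (by rw [abs_of_nonneg (by omega)]; omega)
  obtain ⟨hrec, hper⟩ := hx
  obtain ⟨hxR, hxL⟩ := mem_recurrentSet_iff.1 hrec
  have hzl : ∀ k < (-n : ℤ), openPattern x k = openPattern y k := fun k hk => by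
    rw [openPattern, openPattern, hleft k hk]
  have hyL : LeftUnbounded (openPattern y) := hxL.congr hzl
  have ex := eq_bracketSeq_of_mem_dyckShift hxX hxL
  have ey := eq_bracketSeq_of_mem_dyckShift hyX hyL
  have runx : ∀ r q, stackRun (blockList x r q)
      (stackAt (openPattern x) (fun k => (x k).label) r) =
      some (stackAt (openPattern x) (fun k => (x k).label) (r + q)) := fun r q => by
    have := stackRun_bracketSeq hxL (fun k => (x k).label) r q
    rwa [← ex] at this
  have runy : ∀ r q, stackRun (blockList y r q)
      (stackAt (openPattern y) (fun k => (y k).label) r) =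
      some (stackAt (openPattern y) (fun k => (y k).label) (r + q)) := fun r q => by
    have := stackRun_bracketSeq hyL (fun k => (y k).label) r q
    rwa [← ey] at this
  have hpos : ∀ i, openPos (openPattern y) (-n) i = openPos (openPattern x) (-n) i := fun i =>
    (openPos_congr hzl i).symm
  set σ := stackAt (openPattern x) (fun k => (x k).label) (-n) with hσ
  have hσy : stackAt (openPattern y) (fun k => (y k).label) (-n) = σ := by
    funext i
    rw [hσ, stackAt, stackAt, hpos, hleft _ (openPos_lt hxL _ i)]
  set wx := blockList x (-n) (2 * n + 1) with hwx
  set wy := blockList y (-n) (2 * n + 1) with hwy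
  have hlx : wx.length = 2 * n + 1 := length_blockList _ _ _
  have hly : wy.length = 2 * n + 1 := length_blockList _ _ _
  have endpt : (-n : ℤ) + (2 * n + 1 : ℕ) = n + 1 := by push_cast; ring
  have hsx := runx (-n) (2 * n + 1)
  have hsy := runy (-n) (2 * n + 1)
  rw [← hwx, ← hσ, endpt] at hsx
  rw [← hwy, hσy, endpt] at hsy
  have htail : ∀ q : ℕ, blockList y (n + 1) q = blockList x (n + 1) q := fun q =>
    blockList_eq_iff.2 fun k hk _ => (hright k hk).symm
  -- If the stacks differed at depth `i`, continue to the right until the height has dropped by `i +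
  -- 1`: the common tail would have popped two different entries with the same letter.
  have hss : stackAt (openPattern x) (fun k => (x k).label) (n + 1) =
      stackAt (openPattern y) (fun k => (y k).label) (n + 1) := by
    funext i
    by_contra hne
    obtain ⟨l, hl, hlc⟩ := hxR (n + 1) (height (openPattern x) (n + 1) - i - 1)
    obtain ⟨q, rfl⟩ := Int.le.dest hl.le
    have h1 := runx (n + 1) q
    have h2 := runy (n + 1) q
    rw [htail] at h2
    have := nonneg_of_stackRun_ne_none (by rw [h1]; simp) (by rw [h2]; simp) hne
    rw [wordHeight_blockList] at this
    omega
  rw [← hss] at hsy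
  set s := stackAt (openPattern x) (fun k => (x k).label) (n + 1) with hs
  have bx := abs_le.1 (abs_wordHeight_le wx)
  have bby := abs_le.1 (abs_wordHeight_le wy)
  rw [hlx] at bx
  rw [hly] at bby
  -- Each word moves the deep entries of `σ` by its height, and the results coincide. Heights
  -- differing by `d > 0` would make `σ` periodic with period `d` beyond the length of the words.
  have hheight : wordHeight wx = wordHeight wy := by
    have aux : ∀ {u v : List (DyckLetter m)} {n' : ℕ}, u.length = n' → v.length = n' →
        stackRun u σ = some s → stackRun v σ = some s → ¬ wordHeight u < wordHeight v := by
      intro u v n' hu hv h1 h2 hlt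
      obtain ⟨d, hd⟩ := Int.le.dest hlt.le
      obtain ⟨i, hi, hne⟩ := hper (-n) d n' (by omega)
      have b := abs_le.1 (abs_wordHeight_le v)
      obtain ⟨k, hk⟩ := Int.eq_ofNat_of_zero_le (show 0 ≤ (i : ℤ) + wordHeight v by omega)
      have t1 := stackRun_apply_of_length_le h2 (i := i) (k := k) (by omega) hk.symm
      have t2 := stackRun_apply_of_length_le h1 (i := i + d) (k := k) (by omega)
        (by push_cast; omega)
      exact hne (t2.symm.trans t1)
    exact le_antisymm (not_lt.1 (aux hly hlx hsy hsx)) (not_lt.1 (aux hlx hly hsx hsy))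
  have hcount : openingCount wx = openingCount wy := by
    have h1 := wordHeight_eq wx
    have h2 := wordHeight_eq wy
    rw [hlx] at h1
    rw [hly] at h2
    omega
  -- The margin from `-N` to `-n` is to open the top `3L` brackets of `σ`, where `L = 2 * n + 1`:
  -- `L` entries for the letters the words may consult, and `2L` for comparing the results.
  obtain ⟨N, hN⟩ : ∃ N : ℕ, ∀ i < 3 * (2 * n + 1), -(N : ℤ) ≤ openPos (openPattern x) (-n) i := by
    refine ⟨(Finset.range (3 * (2 * n + 1))).sup fun i =>
      (openPos (openPattern x) (-n) i).natAbs, fun i hi => ?_⟩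
    have := Finset.le_sup (f := fun i => (openPos (openPattern x) (-n) i).natAbs)
      (Finset.mem_range.2 hi)
    omega
  have hnN : n ≤ N := by
    have h1 := hN 0 (by omega)
    have h2 := openPos_lt hxL (-n) 0
    omega
  refine ⟨N, fun k hk => hn k (by omega), ?_⟩
  rw [blockList_centred x hnN, blockList_centred y hnN, ← hwx, ← hwy, htail,
    ← List.append_assoc, ← List.append_assoc]
  have hp : blockList y (-N) (N - n) = blockList x (-N) (N - n) :=
    blockList_eq_iff.2 fun k hk hk' => (hleft k (by omega)).symm
  rw [hp]
  have key : SameAction (blockList x (-N) (N - n) ++ wx) (blockList x (-N) (N - n) ++ wy) := by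
    refine ⟨fun τ => ?_, by simp only [openingCount_append, hcount]⟩
    rw [stackRun_append, stackRun_append]
    cases hτ : stackRun (blockList x (-N) (N - n)) τ with
    | none => rfl
    | some τ₁ =>
      rw [Option.bind_some, Option.bind_some]
      have hτ₁ : ∀ i < 3 * (2 * n + 1), τ₁ i = σ i := by
        intro i hi
        rw [show (-N : ℤ) = -n - (N - n : ℕ) by omega] at hτ
        exact stackRun_blockList_apply hxL (by have := hN i hi; omega) hτ
      obtain ⟨t, ht, htk⟩ := exists_stackRun_eq hsx (k := 2 * (2 * n + 1)) (s' := τ₁)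
        fun i hi => hτ₁ i (by omega)
      obtain ⟨t', ht', htk'⟩ := exists_stackRun_eq hsy (k := 2 * (2 * n + 1)) (s' := τ₁)
        fun i hi => hτ₁ i (by omega)
      rw [ht, ht']
      congr 1
      funext k
      -- With `L = 2 * n + 1`, both results agree with `s` below `2L`. An entry at depth `k ≥ 2L`
      -- comes from depth `k - wordHeight wx ≥ L`, which neither word reaches, and the heights are
      -- equal.
      rcases lt_or_ge k (2 * (2 * n + 1)) with hk | hk
      · rw [htk k hk, htk' k hk]
      · obtain ⟨i, hi⟩ := Int.eq_ofNat_of_zero_le (show 0 ≤ (k : ℤ) - wordHeight wx by omega)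
        rw [stackRun_apply_of_length_le ht (i := i) (k := k) (by omega) (by omega),
          stackRun_apply_of_length_le ht' (i := i) (k := k) (by omega) (by omega)]
  have := key.append [] (blockList x (n + 1) (N - n))
  simpa using this

end Generic

/-! ### Double-tail invariance -/

section Invariance

variable {m : ℕ}

instance [NeZero m] : StandardBorelSpace (dyckShift m) := measurableSet_dyckShift.standardBorel

theorem muFull_image_replaceBlock (hm : 2 ≤ m) {y y' : ℤ → DyckLetter m} {N : ℕ}
    (h : SameAction (blockList y (-N) (2 * N + 1)) (blockList y' (-N) (2 * N + 1)))
    {D : Set (ℤ → DyckLetter m)} (hD : MeasurableSet D)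
    (hDy : D ⊆ cylSet y (-N) (2 * N + 1)) :
    muFull m (replaceBlock y' (-N) (2 * N + 1) '' D) = muFull m D := by
  -- On these cylinders the two replacements are inverse to each other, so the image is a preimage
  -- under the reverse one.
  have e : replaceBlock y' (-N) (2 * N + 1) '' D =
      replaceBlock y (-N) (2 * N + 1) ⁻¹' D ∩ cylSet y' (-N) (2 * N + 1) := by
    have hinv : ∀ (u v x : ℤ → DyckLetter m), x ∈ cylSet u (-N) (2 * N + 1) →
        replaceBlock u (-N) (2 * N + 1) (replaceBlock v (-N) (2 * N + 1) x) = x := by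
      intro u v x hx
      funext k
      by_cases hk : (-N : ℤ) ≤ k ∧ k < -N + (2 * N + 1 : ℕ)
      · rw [replaceBlock_of_mem hk]
        exact (blockList_eq_iff.1 (mem_cylSet.1 hx) k hk.1 hk.2).symm
      · rw [replaceBlock_of_notMem hk, replaceBlock_of_notMem hk]
    ext x
    constructor
    · rintro ⟨x, hx, rfl⟩
      refine ⟨?_, ?_⟩
      · rw [Set.mem_preimage, hinv _ _ _ (hDy hx)]; exact hx
      · exact blockList_eq_iff.2 fun k hk hk' => replaceBlock_of_mem ⟨hk, hk'⟩
    · rintro ⟨h1, h2⟩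
      exact ⟨_, h1, hinv _ _ _ h2⟩
  rw [e, ← Measure.restrict_apply (measurable_replaceBlock _ _ _ hD),
    ← Measure.map_apply (measurable_replaceBlock _ _ _) hD, map_replaceBlock_muFull hm h.symm,
    Measure.restrict_apply hD, Set.inter_eq_left.2 hDy]

/-- The domain splits into countably many pieces, by a window on which the actions agree and by the
two blocks there; on such a piece `g` is a block replacement. Pulling both measures back to `S`
allows them to be compared piece by piece. The index `none` collects the points without such a
window, which are negligible. -/
theorem doubleTailInvariant_muTilde (hm : 2 ≤ m) : DoubleTailInvariant (muTilde m) := by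
  have : NeZero m := ⟨by omega⟩
  intro S g hg
  have := hg.measurableSet_domain.standardBorel
  have hembg : MeasurableEmbedding g := hg.measurable.measurableEmbedding hg.injective
  have hembS : MeasurableEmbedding (Subtype.val : S → dyckShift m) :=
    MeasurableEmbedding.subtype_coe hg.measurableSet_domain
  have hembX : MeasurableEmbedding (Subtype.val : dyckShift m → ℤ → DyckLetter m) :=
    MeasurableEmbedding.subtype_coe measurableSet_dyckShift
  set related : ℕ → S → Prop := fun N x =>
    (∀ k : ℤ, (N : ℤ) < |k| → x.1.1 k = (g x).1 k) ∧
      SameAction (blockList x.1.1 (-N) (2 * N + 1)) (blockList (g x).1 (-N) (2 * N + 1))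
    with hrelated
  set C : Option (ℕ × List (DyckLetter m) × List (DyckLetter m)) → Set S := fun i =>
    match i with
    | none => {x | ∀ N, ¬ related N x}
    | some (N, u, v) => {x | related N x ∧ blockList x.1.1 (-N) (2 * N + 1) = u ∧
        blockList (g x).1 (-N) (2 * N + 1) = v} with hC
  have hcover : ⋃ i, C i = Set.univ := by
    refine Set.eq_univ_of_forall fun x => ?_
    by_cases h : ∀ N, ¬ related N x
    · exact Set.mem_iUnion.2 ⟨none, h⟩
    · push Not at h
      obtain ⟨N, hN⟩ := h
      exact Set.mem_iUnion.2 ⟨some (N, _, _), hN, rfl, rfl⟩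
  have hx1 : Measurable fun x : S => x.1.1 := hembX.measurable.comp hembS.measurable
  have hg1 : Measurable fun x : S => (g x).1 := hembX.measurable.comp hg.measurable
  have hnull : ∀ {B : Set (dyckShift m)}, (∀ x ∈ B, ¬ IsGeneric x.1) → muTilde m B = 0 := by
    intro B hB
    rw [muTilde_apply]
    refine measure_mono_null ?_ (ae_iff.1 (ae_isGeneric hm))
    rintro _ ⟨x, hx, rfl⟩
    exact hB x hx
  have key : (muTilde m).comap g = (muTilde m).comap (Subtype.val : S → dyckShift m) := by
    refine Measure.ext_of_iUnion_eq_univ hcover fun i => ?_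
    rcases i with _ | ⟨N, u, v⟩
    · rw [Measure.restrict_eq_zero.2, Measure.restrict_eq_zero.2]
      · rw [hembS.comap_apply]
        refine hnull ?_
        rintro _ ⟨x, hx, rfl⟩ hgen
        obtain ⟨N, hN⟩ := exists_sameAction hm hgen (hg.doubleTail x)
        exact hx N hN
      -- That the image is null does not follow from the domain being null; here `g x` is the
      -- generic point, and `exists_sameAction` is applied with `x` and `g x` exchanged.
      · rw [hembg.comap_apply]
        refine hnull ?_
        rintro _ ⟨x, hx, rfl⟩ hgen
        obtain ⟨n, hn⟩ := hg.doubleTail x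
        obtain ⟨N, hN, hN'⟩ := exists_sameAction hm (y := x.1) hgen
          ⟨n, fun k hk => (hn k hk).symm⟩
        exact hx N ⟨fun k hk => (hN k hk).symm, hN'.symm⟩
    · rcases (C (some (N, u, v))).eq_empty_or_nonempty with he | ⟨x₀, hx₀⟩
      · rw [he]; simp
      · obtain ⟨hrel, rfl, rfl⟩ := hx₀
        have hCm : MeasurableSet (C (some (N, blockList x₀.1.1 (-N) (2 * N + 1),
            blockList (g x₀).1 (-N) (2 * N + 1)))) := by
          have e : C (some (N, blockList x₀.1.1 (-N) (2 * N + 1),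
              blockList (g x₀).1 (-N) (2 * N + 1))) =
              (⋂ k : ℤ, {x | (N : ℤ) < |k| → x.1.1 k = (g x).1 k}) ∩
              ({x | blockList x.1.1 (-N) (2 * N + 1) = blockList x₀.1.1 (-N) (2 * N + 1)} ∩
              {x | blockList (g x).1 (-N) (2 * N + 1) = blockList (g x₀).1 (-N) (2 * N + 1)}) := by
            ext x
            simp only [hC, hrelated, Set.mem_ofPred_eq, Set.mem_inter_iff, Set.mem_iInter]
            constructor
            · rintro ⟨⟨h1, -⟩, h2, h3⟩
              exact ⟨h1, h2, h3⟩
            · rintro ⟨h1, h2, h3⟩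
              exact ⟨⟨h1, by rw [h2, h3]; exact hrel.2⟩, h2, h3⟩
          rw [e]
          refine (MeasurableSet.iInter fun k => ?_).inter
            ((hx1 (measurableSet_blockList _ _ _)).inter (hg1 (measurableSet_blockList _ _ _)))
          by_cases hk : (N : ℤ) < |k|
          · simp only [hk, true_imp_iff]
            exact measurableSet_eq_fun ((measurable_pi_apply k).comp hx1)
              ((measurable_pi_apply k).comp hg1)
          · simp [hk]
        ext P hP
        rw [Measure.restrict_apply hP, Measure.restrict_apply hP, hembg.comap_apply,
          hembS.comap_apply, muTilde_apply, muTilde_apply]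
        have hPC := hP.inter hCm
        have hD := hembX.measurableSet_image.2 (hembS.measurableSet_image.2 hPC)
        rw [← muFull_image_replaceBlock hm hrel.2 hD]
        · congr 1
          rw [Set.image_image, Set.image_image, Set.image_image]
          refine Set.image_congr fun x hx => ?_
          obtain ⟨-, hx1, hx2, hx3⟩ := hx
          funext k
          by_cases hk : (-N : ℤ) ≤ k ∧ k < -N + (2 * N + 1 : ℕ)
          · rw [replaceBlock_of_mem hk]
            exact blockList_eq_iff.1 hx3 k hk.1 hk.2
          · rw [replaceBlock_of_notMem hk]
            refine (hx1.1 k ?_).symm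
            push_cast at hk
            rw [lt_abs]; omega
        · rintro _ ⟨_, ⟨x, hx, rfl⟩, rfl⟩
          exact hx.2.2.1
  have h := congrArg (fun μ => μ Set.univ) key
  simp only [hembg.comap_apply, hembS.comap_apply, Set.image_univ, Subtype.range_coe] at h
  exact h.symm

end Invariance

/-! ### Entropy of finite partitions -/

section Entropy

open Real

/-- The logarithm of the sum dominates that of each positive term. -/
theorem negMulLog_sum_le {ι : Type*} (s : Finset ι) {p : ι → ℝ} (hp : ∀ i ∈ s, 0 ≤ p i) :
    negMulLog (∑ i ∈ s, p i) ≤ ∑ i ∈ s, negMulLog (p i) := by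
  have e : negMulLog (∑ i ∈ s, p i) = ∑ i ∈ s, -p i * log (∑ j ∈ s, p j) := by
    rw [negMulLog, ← Finset.sum_mul, Finset.sum_neg_distrib]
  rw [e]
  refine Finset.sum_le_sum fun i hi => ?_
  rcases (hp i hi).eq_or_lt with h | h
  · simp [← h]
  · have h1 : p i ≤ ∑ j ∈ s, p j := Finset.single_le_sum hp hi
    have h2 := log_le_log h h1
    rw [negMulLog]
    nlinarith

variable {Ω ι κ : Type*} [MeasurableSpace Ω]

/-- The fibres of the map form a measurable partition. -/
def MeasurableFibres {ι : Type*} (P : Ω → ι) : Prop := ∀ i, MeasurableSet (P ⁻¹' {i})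

theorem MeasurableFibres.comp [Countable ι] {P : Ω → ι} (hP : MeasurableFibres P) (f : ι → κ) :
    MeasurableFibres (f ∘ P) := by
  intro j
  have e : (f ∘ P) ⁻¹' {j} = ⋃ i ∈ {i | f i = j}, P ⁻¹' {i} := by
    ext x; simp
  rw [e]
  exact .biUnion (Set.to_countable _) fun i _ => hP i

theorem MeasurableFibres.prodMk {P : Ω → ι} {Q : Ω → κ} (hP : MeasurableFibres P)
    (hQ : MeasurableFibres Q) : MeasurableFibres fun x => (P x, Q x) := by
  rintro ⟨i, j⟩
  have e : (fun x => (P x, Q x)) ⁻¹' {(i, j)} = P ⁻¹' {i} ∩ Q ⁻¹' {j} := by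
    ext x; simp
  rw [e]
  exact (hP i).inter (hQ j)

theorem MeasurableFibres.comp_measurable {ι : Type*} {P : Ω → ι} (hP : MeasurableFibres P)
    {T : Ω → Ω} (hT : Measurable T) : MeasurableFibres (P ∘ T) := fun i => hT (hP i)

theorem MeasurableFibres.itinerary {ι : Type*} {P : Ω → ι} (hP : MeasurableFibres P) {T : Ω → Ω}
    (hT : Measurable T) (n : ℕ) : MeasurableFibres (itinerary T P n) := by
  intro w
  have e : _root_.itinerary T P n ⁻¹' {w} = ⋂ j : Fin n, (P ∘ T^[j]) ⁻¹' {w j} := by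
    ext x; simp [_root_.itinerary, funext_iff]
  rw [e]
  exact .iInter fun j => hP.comp_measurable (hT.iterate j) (w j)

variable {μ : Measure Ω}

theorem measureReal_preimage_comp [Fintype ι] [IsProbabilityMeasure μ] {P : Ω → ι} (hP : MeasurableFibres P) (f : ι → κ)
    [DecidableEq κ] (j : κ) :
    μ.real ((f ∘ P) ⁻¹' {j}) = ∑ i with f i = j, μ.real (P ⁻¹' {i}) := by
  rw [← measureReal_biUnion_finset]
  · congr 1
    ext x; simp
  · intro i _ i' _ hne
    exact Disjoint.preimage P (Set.disjoint_singleton.2 hne)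
  · exact fun i _ => hP i

theorem partitionEntropy_comp_le [Fintype ι] [Fintype κ] [IsProbabilityMeasure μ]
    {P : Ω → ι} (hP : MeasurableFibres P) (f : ι → κ) :
    partitionEntropy μ (f ∘ P) ≤ partitionEntropy μ P := by
  classical
  unfold partitionEntropy
  simp only [measureReal_preimage_comp hP f]
  rw [← Finset.sum_fiberwise (s := Finset.univ) (g := f)]
  exact Finset.sum_le_sum fun j _ => negMulLog_sum_le _ fun i _ => measureReal_nonneg

theorem partitionEntropy_le_of_factorsThrough [Fintype ι] [Fintype κ] [IsProbabilityMeasure μ]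
    {P : Ω → ι} (hP : MeasurableFibres P) {Q : Ω → κ}
    (h : ∀ x y, P x = P y → Q x = Q y) : partitionEntropy μ Q ≤ partitionEntropy μ P := by
  obtain ⟨x₀⟩ : Nonempty Ω := nonempty_of_isProbabilityMeasure μ
  have e : Function.extend P Q (fun _ => Q x₀) ∘ P = Q :=
    Function.FactorsThrough.extend_comp _ fun x y => h x y
  rw [← e]
  exact partitionEntropy_comp_le hP _

theorem sum_measureReal_preimage [Fintype ι] [IsProbabilityMeasure μ] {P : Ω → ι} (hP : MeasurableFibres P) :
    ∑ i, μ.real (P ⁻¹' {i}) = 1 := by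
  classical
  have := measureReal_preimage_comp (μ := μ) hP (fun _ => ()) ()
  rw [show ((fun _ => ()) ∘ P) ⁻¹' {()} = Set.univ from Set.eq_univ_of_forall fun _ => rfl,
    probReal_univ] at this
  simpa using this.symm

/-- Gibbs' inequality: sum `log t ≤ t - 1` at `t = a i * b j / p (i, j)` with weights `p (i, j)`;
the correction terms have total mass `1 - 1`. -/
theorem partitionEntropy_prodMk_le [Fintype ι] [Fintype κ] [IsProbabilityMeasure μ]
    {P : Ω → ι} {Q : Ω → κ} (hP : MeasurableFibres P)
    (hQ : MeasurableFibres Q) :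
    partitionEntropy μ (fun x => (P x, Q x)) ≤ partitionEntropy μ P + partitionEntropy μ Q := by
  classical
  set R : Ω → ι × κ := fun x => (P x, Q x) with hR
  have hRm : MeasurableFibres R := hP.prodMk hQ
  set p : ι × κ → ℝ := fun ij => μ.real (R ⁻¹' {ij}) with hp
  have h1 : ∀ i, μ.real (P ⁻¹' {i}) = ∑ j, p (i, j) := by
    intro i
    have := measureReal_preimage_comp (μ := μ) hRm Prod.fst i
    rw [show Prod.fst ∘ R = P from rfl] at this
    rw [this, Finset.sum_filter, Fintype.sum_prod_type, Finset.sum_eq_single i]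
    · simp [hp]
    · intro b _ hb; simp [hb]
    · simp
  have h2 : ∀ j, μ.real (Q ⁻¹' {j}) = ∑ i, p (i, j) := by
    intro j
    have := measureReal_preimage_comp (μ := μ) hRm Prod.snd j
    rw [show Prod.snd ∘ R = Q from rfl] at this
    rw [this, Finset.sum_filter, Fintype.sum_prod_type_right, Finset.sum_eq_single j]
    · simp [hp]
    · intro b _ hb; simp [hb]
    · simp
  have hpn : ∀ ij, 0 ≤ p ij := fun ij => measureReal_nonneg
  set a : ι → ℝ := fun i => μ.real (P ⁻¹' {i}) with ha
  set b : κ → ℝ := fun j => μ.real (Q ⁻¹' {j}) with hb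
  have key : ∀ ij : ι × κ, negMulLog (p ij) ≤
      -p ij * log (a ij.1) + -p ij * log (b ij.2) + (a ij.1 * b ij.2 - p ij) := by
    rintro ⟨i, j⟩
    rcases (hpn (i, j)).eq_or_lt with h | h
    · rw [← h]
      simpa using mul_nonneg (measureReal_nonneg (μ := μ)) (measureReal_nonneg (μ := μ))
    · have hai : 0 < a i := by
        have : p (i, j) ≤ a i := by
          rw [ha]; dsimp only
          rw [h1 i]
          exact Finset.single_le_sum (f := fun j => p (i, j)) (fun j _ => hpn _)
            (Finset.mem_univ j)
        linarith
      have hbj : 0 < b j := by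
        have : p (i, j) ≤ b j := by
          rw [hb]; dsimp only
          rw [h2 j]
          exact Finset.single_le_sum (f := fun i => p (i, j)) (fun j _ => hpn _)
            (Finset.mem_univ i)
        linarith
      have hlog := log_le_sub_one_of_pos (div_pos (mul_pos hai hbj) h)
      rw [log_div (mul_pos hai hbj).ne' h.ne', log_mul hai.ne' hbj.ne'] at hlog
      have := mul_le_mul_of_nonneg_left hlog h.le
      rw [mul_sub, mul_sub, mul_one, mul_div_cancel₀ _ h.ne', mul_add] at this
      rw [negMulLog]
      simp only
      linarith
  have hsum := Finset.sum_le_sum fun ij (_ : ij ∈ (Finset.univ : Finset (ι × κ))) => key ij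
  rw [Finset.sum_add_distrib, Finset.sum_add_distrib, Finset.sum_sub_distrib] at hsum
  have s1 : ∑ ij : ι × κ, -p ij * log (a ij.1) = ∑ i, negMulLog (a i) := by
    rw [Fintype.sum_prod_type]
    refine Finset.sum_congr rfl fun i _ => ?_
    simp only
    rw [negMulLog, ← Finset.sum_mul, Finset.sum_neg_distrib, ← h1 i]
  have s2 : ∑ ij : ι × κ, -p ij * log (b ij.2) = ∑ j, negMulLog (b j) := by
    rw [Fintype.sum_prod_type_right]
    refine Finset.sum_congr rfl fun j _ => ?_
    simp only
    rw [negMulLog, ← Finset.sum_mul, Finset.sum_neg_distrib, ← h2 j]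
  have s3 : ∑ ij : ι × κ, a ij.1 * b ij.2 = 1 := by
    rw [Fintype.sum_prod_type, ← Finset.sum_mul_sum, ha, hb, sum_measureReal_preimage hP,
      sum_measureReal_preimage hQ, one_mul]
  have s4 : ∑ ij : ι × κ, p ij = 1 := sum_measureReal_preimage hRm
  rw [s1, s2, s3, s4] at hsum
  unfold partitionEntropy
  linarith

theorem partitionEntropy_comp_measurePreserving [Fintype ι] {P : Ω → ι} (hP : MeasurableFibres P)
    {T : Ω → Ω} (hT : MeasurePreserving T μ μ) :
    partitionEntropy μ (P ∘ T) = partitionEntropy μ P := by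
  unfold partitionEntropy
  refine Finset.sum_congr rfl fun i _ => ?_
  rw [Set.preimage_comp, measureReal_def, measureReal_def,
    hT.measure_preimage (hP i).nullMeasurableSet]

theorem partitionEntropy_itinerary_le [Fintype ι] [IsProbabilityMeasure μ] {P : Ω → ι} (hP : MeasurableFibres P)
    {T : Ω → Ω} (hT : MeasurePreserving T μ μ) (n : ℕ) :
    partitionEntropy μ (itinerary T P n) ≤ n * partitionEntropy μ P := by
  induction n with
  | zero =>
    have h : (itinerary T P 0 ⁻¹' {default}) = Set.univ :=
      Set.eq_univ_of_forall fun x => Subsingleton.elim _ _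
    simp [partitionEntropy, h]
  | succ n ih =>
    have hI := (hP.itinerary hT.measurable n).comp_measurable hT.measurable
    have h1 : partitionEntropy μ (itinerary T P (n + 1)) ≤
        partitionEntropy μ (fun x => (P x, (itinerary T P n ∘ T) x)) := by
      refine partitionEntropy_le_of_factorsThrough (hP.prodMk hI) fun x y hxy => ?_
      rw [Prod.mk.injEq] at hxy
      funext j
      refine Fin.cases ?_ (fun j => ?_) j
      · exact hxy.1
      · exact congrFun hxy.2 j
    have h2 := partitionEntropy_prodMk_le (μ := μ) hP hI
    rw [partitionEntropy_comp_measurePreserving (hP.itinerary hT.measurable n) hT] at h2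
    push_cast
    linarith

/-- Replacing a partition by one which differs from it on a small set. -/
theorem partitionEntropy_itinerary_le_add [Fintype ι] [DecidableEq ι]
    [IsProbabilityMeasure μ] {P Q : Ω → ι} (hP : MeasurableFibres P)
    (hQ : MeasurableFibres Q) {T : Ω → Ω} (hT : MeasurePreserving T μ μ) (n : ℕ) :
    partitionEntropy μ (itinerary T P n) ≤ partitionEntropy μ (itinerary T Q n) +
      n * partitionEntropy μ (fun x => if P x = Q x then none else some (P x)) := by
  -- `E` corrects `Q`: the value of `P` is recovered from those of `Q` and `E`.
  set E : Ω → Option ι := fun x => if P x = Q x then none else some (P x) with hE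
  have hEm : MeasurableFibres E :=
    (hP.prodMk hQ).comp fun ij : ι × ι => if ij.1 = ij.2 then none else some ij.1
  have h1 : partitionEntropy μ (itinerary T P n) ≤
      partitionEntropy μ (fun x => (itinerary T Q n x, itinerary T E n x)) := by
    refine partitionEntropy_le_of_factorsThrough
      ((hQ.itinerary hT.measurable n).prodMk (hEm.itinerary hT.measurable n)) fun x y hxy => ?_
    rw [Prod.mk.injEq] at hxy
    funext j
    have hq : Q (T^[j] x) = Q (T^[j] y) := congrFun hxy.1 j
    have he : E (T^[j] x) = E (T^[j] y) := congrFun hxy.2 j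
    show P (T^[j] x) = P (T^[j] y)
    simp only [hE] at he
    split_ifs at he with h2 h3 h3
    · rw [h2, h3, hq]
    · simpa using he
  have h2 := partitionEntropy_prodMk_le (μ := μ) (hQ.itinerary hT.measurable n)
    (hEm.itinerary hT.measurable n)
  have h3 := partitionEntropy_itinerary_le (μ := μ) hEm hT n
  linarith

/-- One atom has mass near one and the others near zero, and `negMulLog` is continuous and vanishes
at both ends. It matters that `δ` depends only on `ι` and `ε`: the approximating partition is chosen
after it. -/
theorem exists_partitionEntropy_lt (ι : Type*) [Fintype ι] {ε : ℝ} (hε : 0 < ε) :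
    ∃ δ > 0, ∀ {Ω : Type} [MeasurableSpace Ω] {μ : Measure Ω} [IsProbabilityMeasure μ]
      {E : Ω → Option ι}, MeasurableFibres E → μ.real {x | E x ≠ none} < δ →
      partitionEntropy μ E < ε := by
  set k : ℝ := Fintype.card ι + 1 with hk
  have hkpos : 0 < k := by positivity
  have hc := continuous_negMulLog
  obtain ⟨δ₀, hδ₀, h₀⟩ := Metric.continuous_iff.1 hc 0 (ε / k) (by positivity)
  obtain ⟨δ₁, hδ₁, h₁⟩ := Metric.continuous_iff.1 hc 1 (ε / k) (by positivity)
  refine ⟨min δ₀ δ₁, lt_min hδ₀ hδ₁, ?_⟩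
  intro Ω _ μ _ E hE hlt
  have hnone : negMulLog (μ.real (E ⁻¹' {none})) < ε / k := by
    have hcompl : {x | E x ≠ none} = (E ⁻¹' {none})ᶜ := by ext x; simp
    rw [hcompl, probReal_compl_eq_one_sub (hE none)] at hlt
    have hle : μ.real (E ⁻¹' {none}) ≤ 1 := measureReal_le_one
    have := h₁ (μ.real (E ⁻¹' {none})) (by
      rw [Real.dist_eq, abs_sub_comm, abs_of_nonneg (by linarith)]
      exact hlt.trans_le (min_le_right _ _))
    rw [Real.dist_eq, negMulLog_one, sub_zero] at this
    exact (le_abs_self _).trans_lt this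
  have hsome : ∀ i, negMulLog (μ.real (E ⁻¹' {some i})) ≤ ε / k := by
    intro i
    have hle : μ.real (E ⁻¹' {some i}) ≤ μ.real {x | E x ≠ none} :=
      measureReal_mono fun x hx => by
        have hx : E x = some i := hx
        simp [hx]
    have := h₀ (μ.real (E ⁻¹' {some i})) (by
      rw [Real.dist_eq, sub_zero, abs_of_nonneg measureReal_nonneg]
      exact (hle.trans_lt hlt).trans_le (min_le_left _ _))
    rw [Real.dist_eq, negMulLog_zero, sub_zero] at this
    exact (le_abs_self _).trans this.le
  unfold partitionEntropy
  rw [Fintype.sum_option]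
  have hsum : ∑ i, negMulLog (μ.real (E ⁻¹' {some i})) ≤ Fintype.card ι * (ε / k) := by
    refine (Finset.sum_le_sum fun i _ => hsome i).trans ?_
    simp
  have : ε / k + Fintype.card ι * (ε / k) = ε := by
    rw [hk]; field_simp; ring
  linarith

end Entropy

/-! ### Entropy of the measure -/

section KolmogorovSinai

open Real

variable {m : ℕ}

/-- The word at the places `r, …, r + n - 1`. -/
def wordAt (r : ℤ) (n : ℕ) (x : dyckShift m) (j : Fin n) : DyckLetter m := x.1 (r + (j : ℕ))

theorem wordAt_eq_iff {r : ℤ} {n : ℕ} {x y : dyckShift m} :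
    wordAt r n x = wordAt r n y ↔ blockList x.1 r n = blockList y.1 r n := by
  rw [blockList_eq_iff, funext_iff]
  constructor
  · intro h k hk hk'
    obtain ⟨i, rfl⟩ := Int.le.dest hk
    exact h ⟨i, by omega⟩
  · intro h j
    exact h _ (by omega) (by have := j.2; omega)

theorem measurable_wordAt (r : ℤ) (n : ℕ) : Measurable (wordAt (m := m) r n) :=
  measurable_pi_lambda _ fun _ => (measurable_pi_apply _).comp measurable_subtype_coe

theorem measurableFibres_of_measurable {Ω ι : Type*} [MeasurableSpace Ω] [MeasurableSpace ι]
    [MeasurableSingletonClass ι] {P : Ω → ι} (hP : Measurable P) : MeasurableFibres P :=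
  fun i => hP (measurableSet_singleton i)

theorem openingCount_blockList (x : ℤ → DyckLetter m) (r : ℤ) (n : ℕ) :
    openingCount (blockList x r n) = upCount n fun i => openPattern x (r + i) := by
  induction n generalizing r with
  | zero => rfl
  | succ n ih =>
    have e : (fun i : ℕ => openPattern x (r + 1 + i)) =
        fun i : ℕ => openPattern x (r + (i + 1 : ℕ)) := by
      funext i; congr 1; push_cast; ring
    rw [blockList_succ, upCount, ← e, ← ih (r + 1)]
    cases hx : x r <;> simp [openPattern, hx, DyckLetter.isOpening, openingCount]

theorem unmatchedCount_blockList (x : ℤ → DyckLetter m) (r : ℤ) (n : ℕ) :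
    unmatchedCount (blockList x r n) = walkDepth n fun i => openPattern x (r + i) := by
  induction n generalizing r with
  | zero => rfl
  | succ n ih =>
    have e : (fun i : ℕ => openPattern x (r + 1 + i)) =
        fun i : ℕ => openPattern x (r + (i + 1 : ℕ)) := by
      funext i; congr 1; push_cast; ring
    rw [blockList_succ, walkDepth, ← e, ← ih (r + 1)]
    cases hx : x r <;> simp [openPattern, hx, DyckLetter.isOpening, unmatchedCount]

/-- The entropy of words of length `n`. -/
noncomputable def wordEntropy (m n : ℕ) : ℝ :=
  n * log 2 + (n / 2 + ∫ w, (walkDepth n w : ℝ) ∂coinMeasure) * log m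

theorem map_pattern_muTilde [NeZero m] (r : ℤ) :
    (muTilde m).map (fun x (i : ℕ) => openPattern x.1 (r + i)) = coinMeasure := by
  have h1 : Measurable fun (z : ℤ → Bool) (i : ℕ) => z (r + i) := by fun_prop
  have e1 : (fun (x : dyckShift m) (i : ℕ) => openPattern x.1 (r + i)) =
      ((fun (z : ℤ → Bool) (i : ℕ) => z (r + i)) ∘ openPattern) ∘ Subtype.val := rfl
  have e2 : openPattern ∘ dyckF (m := m) = Prod.fst := by
    funext p
    exact openPattern_bracketSeq _ _
  rw [e1, ← Measure.map_map (h1.comp measurable_openPattern) measurable_subtype_coe,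
    map_val_muTilde, muFull_eq_map, ← Measure.map_map h1 measurable_openPattern,
    Measure.map_map measurable_openPattern measurable_dyckF, e2]
  rw [← Measure.fst, Measure.fst_prod, map_symmetricProduct_bool]

theorem negMulLog_cylWeight [NeZero m] (w : List (DyckLetter m)) :
    negMulLog (cylWeight w).toReal = (cylWeight w).toReal *
      (w.length * log 2 + (openingCount w + unmatchedCount w) * log m) := by
  have hm : (m : ℝ) ≠ 0 := by exact_mod_cast NeZero.ne m
  have e : (cylWeight w).toReal =
      (2 : ℝ)⁻¹ ^ w.length * (m : ℝ)⁻¹ ^ (openingCount w + unmatchedCount w) := by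
    simp [cylWeight]
  rw [negMulLog, e, log_mul (by positivity) (by positivity), log_pow, log_pow, log_inv, log_inv]
  push_cast
  ring

/-- The entropy is the mean information of a word, which depends only on its bracket pattern; under
`muTilde` that pattern is a sequence of fair coins, so the mean is an integral over the walk. -/
theorem partitionEntropy_wordAt [NeZero m] (r : ℤ) (n : ℕ) :
    partitionEntropy (muTilde m) (wordAt r n) = wordEntropy m n := by
  classical
  have hext : ∀ w : Fin n → DyckLetter m, ∃ y : ℤ → DyckLetter m, ∀ j : Fin n,
      y (r + (j : ℕ)) = w j := by
    intro w
    refine ⟨fun k => if h : 0 ≤ k - r ∧ (k - r).toNat < n then w ⟨(k - r).toNat, h.2⟩ else .α 0,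
      fun j => ?_⟩
    have h : 0 ≤ r + ((j : ℕ) : ℤ) - r ∧ (r + ((j : ℕ) : ℤ) - r).toNat < n := by
      have := j.2; omega
    dsimp only
    rw [dif_pos h]
    congr 1
    exact Fin.ext (by simp)
  choose y hy using hext
  have hblock : ∀ x : dyckShift m, blockList (y (wordAt r n x)) r n = blockList x.1 r n := by
    intro x
    refine blockList_eq_iff.2 fun k hk hk' => ?_
    obtain ⟨i, rfl⟩ := Int.le.dest hk
    exact hy (wordAt r n x) ⟨i, by omega⟩
  have hfib : ∀ w, wordAt r n ⁻¹' {w} = Subtype.val ⁻¹' cylSet (y w) r n := by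
    intro w
    ext x
    rw [Set.mem_preimage, Set.mem_preimage, Set.mem_singleton_iff, mem_cylSet, blockList_eq_iff]
    constructor
    · rintro rfl k hk hk'
      exact (blockList_eq_iff.1 (hblock x) k hk hk').symm
    · intro h
      funext j
      rw [← hy w j]
      exact h _ (by omega) (by have := j.2; omega)
  set c : List (DyckLetter m) → ℝ := fun w =>
    n * log 2 + (openingCount w + unmatchedCount w) * log m with hc
  have hterm : ∀ w, negMulLog ((muTilde m).real (wordAt r n ⁻¹' {w})) =
      (muTilde m).real (wordAt r n ⁻¹' {w}) * c (blockList (y w) r n) := by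
    intro w
    have e : (muTilde m).real (wordAt r n ⁻¹' {w}) =
        if block (y w) r n ∈ dyckLanguage m then (cylWeight (blockList (y w) r n)).toReal
        else 0 := by
      rw [hfib, measureReal_def, ← Measure.map_apply measurable_subtype_coe
        (measurableSet_cylSet _ _ _), map_val_muTilde, muFull_cylSet]
      split_ifs <;> rfl
    rw [e]
    split_ifs
    · rw [negMulLog_cylWeight, length_blockList]
    · simp
  have hmw := measurable_wordAt (m := m) r n
  unfold partitionEntropy
  simp only [hterm]
  have h1 : ∑ w, (muTilde m).real (wordAt r n ⁻¹' {w}) * c (blockList (y w) r n) =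
      ∫ x, c (blockList (y (wordAt r n x)) r n) ∂muTilde m := by
    have := Measure.isProbabilityMeasure_map (μ := muTilde m) hmw.aemeasurable
    rw [← integral_map (φ := wordAt r n) hmw.aemeasurable
      (f := fun w => c (blockList (y w) r n))
      (measurable_of_finite _).aestronglyMeasurable, integral_fintype Integrable.of_finite]
    refine Finset.sum_congr rfl fun w _ => ?_
    rw [map_measureReal_apply hmw (measurableSet_singleton w), smul_eq_mul]
  rw [h1]
  simp only [hblock, hc, openingCount_blockList, unmatchedCount_blockList]
  have hmp : Measurable fun (x : dyckShift m) (i : ℕ) => openPattern x.1 (r + i) :=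
    measurable_pi_lambda _ fun i => (measurable_pi_apply (X := fun _ : ℤ => Bool) (r + i)).comp
      (measurable_openPattern.comp measurable_subtype_coe)
  have hi : Integrable (fun w => ((upCount n w : ℝ) + walkDepth n w) * log m) coinMeasure :=
    ((integrable_upCount n).add (integrable_walkDepth n)).mul_const (log m)
  have h2 := integral_map (μ := muTilde m) hmp.aemeasurable
    (f := fun w => n * log 2 + ((upCount n w : ℝ) + walkDepth n w) * log m)
    (by rw [map_pattern_muTilde]; exact ((integrable_const _).add hi).aestronglyMeasurable)
  rw [← h2, map_pattern_muTilde, integral_add (integrable_const _) hi,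
    integral_mul_const (log m) fun w => (upCount n w : ℝ) + walkDepth n w,
    integral_add (integrable_upCount n) (integrable_walkDepth n), integral_upCount]
  simp [wordEntropy]

theorem tendsto_wordEntropy_div (m k : ℕ) :
    Tendsto (fun n : ℕ => wordEntropy m (n + k) / n) atTop (nhds (log 2 + 1 / 2 * log m)) := by
  have h1 : Tendsto (fun n : ℕ => wordEntropy m n / n) atTop
      (nhds (log 2 + (1 / 2 + 0) * log m)) := by
    have := ((tendsto_integral_walkDepth_div.const_add (1 / 2)).mul_const (log m)).const_add
      (log 2)
    refine this.congr' ?_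
    filter_upwards [eventually_gt_atTop 0] with n hn
    have : (n : ℝ) ≠ 0 := by positivity
    rw [wordEntropy]; field_simp
  have h2 : Tendsto (fun n : ℕ => ((n + k : ℕ) : ℝ) / n) atTop (nhds 1) := by
    have := (tendsto_const_div_atTop_nhds_zero_nat (k : ℝ)).const_add 1
    rw [add_zero] at this
    refine this.congr' ?_
    filter_upwards [eventually_gt_atTop 0] with n hn
    have : (n : ℝ) ≠ 0 := by positivity
    push_cast; field_simp
  have h3 := (h1.comp (tendsto_add_atTop_nat k)).mul h2
  rw [add_zero, mul_one] at h3
  refine h3.congr' ?_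
  filter_upwards [eventually_gt_atTop 0] with n hn
  have h4 : ((n + k : ℕ) : ℝ) ≠ 0 := by positivity
  simp only [Function.comp_apply]
  field_simp

theorem iterate_dyckT_apply (j : ℕ) (x : dyckShift m) (k : ℤ) :
    ((dyckT m)^[j] x).1 k = x.1 (k + j) := by
  induction j generalizing x with
  | zero => simp
  | succ j ih =>
    rw [Function.iterate_succ_apply, ih]
    exact congrArg x.1 (show k + j + 1 = k + (j + 1 : ℕ) by push_cast; ring)

/-! ### From words to arbitrary finite partitions -/

/-- Cylinders form a ring generating the σ-algebra, so each of the `k` pieces is within `δ / k` of a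
set `t i` depending on finitely many coordinates. Off the union of the symmetric differences, the
window determines the piece. -/
theorem exists_cylinder_approx [NeZero m] {k : ℕ} {P : dyckShift m → Fin k} (hP : Measurable P)
    {δ : ℝ} (hδ : 0 < δ) : ∃ (N : ℕ) (q : List (DyckLetter m) → Fin k),
      (muTilde m).real {x | P x ≠ q (blockList x.1 (-N) (2 * N + 1))} < δ := by
  classical
  obtain ⟨x₀⟩ : Nonempty (dyckShift m) := nonempty_of_isProbabilityMeasure (muTilde m)
  have hemb := MeasurableEmbedding.subtype_coe (measurableSet_dyckShift (m := m))
  have hk : 0 < k := (P x₀).pos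
  have hkR : (0 : ℝ) < k := by exact_mod_cast hk
  have happrox : ∀ i : Fin k, ∃ t ∈ measurableCylinders fun _ : ℤ => DyckLetter m,
      muFull m (symmDiff t (Subtype.val '' (P ⁻¹' {i}))) < ENNReal.ofReal (δ / k) := by
    intro i
    refine exists_measure_symmDiff_lt_of_generateFrom_isSetRing isSetRing_measurableCylinders
      ⟨{Set.univ}, Set.countable_singleton _, ?_, by simp⟩ generateFrom_measurableCylinders.symm
      (hemb.measurableSet_image.2 (hP (measurableSet_singleton i)))
      (ENNReal.ofReal_pos.2 (by positivity))
    rw [Set.singleton_subset_iff]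
    exact univ_mem_measurableCylinders _
  choose t ht htlt using happrox
  have hI : ∀ i, ∃ I : Finset ℤ, ∀ x y : ℤ → DyckLetter m, (∀ l ∈ I, x l = y l) →
      x ∈ t i → y ∈ t i := by
    intro i
    obtain ⟨I, S, -, hS⟩ := (mem_measurableCylinders _).1 (ht i)
    refine ⟨I, fun x y hxy hx => ?_⟩
    rw [hS, mem_cylinder] at hx ⊢
    convert hx using 1
    funext l
    exact (hxy l l.2).symm
  choose I hI using hI
  obtain ⟨N, hN⟩ : ∃ N : ℕ, ∀ i, ∀ l ∈ I i, |l| ≤ N := by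
    refine ⟨Finset.univ.sup fun i => (I i).sup fun l => l.natAbs, fun i l hl => ?_⟩
    have h1 := Finset.le_sup (f := fun l : ℤ => l.natAbs) hl
    have h2 := Finset.le_sup (f := fun i => (I i).sup fun l => l.natAbs) (Finset.mem_univ i)
    rw [Int.abs_eq_natAbs]
    exact_mod_cast h1.trans h2
  have hdep : ∀ i (x y : ℤ → DyckLetter m),
      blockList x (-N) (2 * N + 1) = blockList y (-N) (2 * N + 1) → x ∈ t i → y ∈ t i := by
    intro i x y hxy
    refine hI i x y fun l hl => ?_
    have := abs_le.1 (hN i l hl)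
    exact blockList_eq_iff.1 hxy l this.1 (by push_cast; omega)
  -- A block lying in several `t i`, or in none, may receive any value: its points belong to some
  -- symmetric difference.
  set q : List (DyckLetter m) → Fin k := fun w =>
    if h : ∃ i, ∃ x, blockList x (-N) (2 * N + 1) = w ∧ x ∈ t i then h.choose else P x₀ with hq
  refine ⟨N, q, ?_⟩
  have hsub : {x : dyckShift m | P x ≠ q (blockList x.1 (-N) (2 * N + 1))} ⊆
      ⋃ i : Fin k, Subtype.val ⁻¹' symmDiff (t i) (Subtype.val '' (P ⁻¹' {i})) := by
    intro x hx
    by_contra hnot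
    simp only [Set.mem_iUnion, Set.mem_preimage, Set.mem_symmDiff, not_exists, not_or, not_and,
      not_not] at hnot
    have hmem : ∀ i, x.1 ∈ t i ↔ P x = i := by
      intro i
      constructor
      · intro h
        obtain ⟨x', hx', he⟩ := (hnot i).1 h
        rwa [Subtype.ext he] at hx'
      · intro h
        exact (hnot i).2 ⟨x, h, rfl⟩
    have hex : ∃ i, ∃ x', blockList x' (-N) (2 * N + 1) = blockList x.1 (-N) (2 * N + 1) ∧
        x' ∈ t i := ⟨P x, x.1, rfl, (hmem _).2 rfl⟩
    have hqx : q (blockList x.1 (-N) (2 * N + 1)) = hex.choose := dif_pos hex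
    obtain ⟨x', hx1, hx2⟩ := hex.choose_spec
    exact hx (((hmem _).1 (hdep _ _ _ hx1 hx2)).trans hqx.symm)
  have hle : muTilde m {x : dyckShift m | P x ≠ q (blockList x.1 (-N) (2 * N + 1))} <
      ENNReal.ofReal δ := by
    refine (measure_mono hsub).trans_lt ((measure_iUnion_le _).trans_lt ?_)
    rw [tsum_fintype]
    have hi : ∀ i, muTilde m (Subtype.val ⁻¹' symmDiff (t i) (Subtype.val '' (P ⁻¹' {i}))) <
        ENNReal.ofReal (δ / k) := by
      intro i
      refine lt_of_le_of_lt ?_ (htlt i)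
      rw [muTilde_apply]
      exact measure_mono (Set.image_preimage_subset _ _)
    have hne : (Finset.univ : Finset (Fin k)).Nonempty := ⟨P x₀, Finset.mem_univ _⟩
    calc ∑ i, muTilde m (Subtype.val ⁻¹' symmDiff (t i) (Subtype.val '' (P ⁻¹' {i})))
        < ∑ _i : Fin k, ENNReal.ofReal (δ / k) :=
          ENNReal.sum_lt_sum_of_nonempty hne fun i _ => hi i
      _ = ENNReal.ofReal δ := by
          rw [Finset.sum_const, Finset.card_univ, Fintype.card_fin, ← ENNReal.ofReal_nsmul]
          congr 1
          rw [nsmul_eq_mul]; field_simp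
  rw [measureReal_def]
  exact (ENNReal.toReal_lt_of_lt_ofReal hle)

/-- Up to `ε` per step, `P` may be replaced by a partition read off a finite window, and the
itineraries of the latter are functions of words only boundedly longer. -/
theorem entropyOfPartition_le [NeZero m] {k : ℕ} {P : dyckShift m → Fin k} (hP : Measurable P) :
    entropyOfPartition (muTilde m) (dyckT m) P ≤ ((log 2 + 1 / 2 * log m : ℝ) : EReal) := by
  have hPf := measurableFibres_of_measurable hP
  have key : ∀ ε > 0, entropyOfPartition (muTilde m) (dyckT m) P ≤
      ((log 2 + 1 / 2 * log m + ε : ℝ) : EReal) := by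
    intro ε hε
    obtain ⟨δ, hδ, hE⟩ := exists_partitionEntropy_lt (Fin k) hε
    obtain ⟨N, q, hq⟩ := exists_cylinder_approx hP hδ
    set Q : dyckShift m → Fin k := fun x => q (blockList x.1 (-N) (2 * N + 1)) with hQ
    have hQf : MeasurableFibres Q := measurableFibres_of_measurable
      ((measurable_blockList_comp _ _ q).comp measurable_subtype_coe)
    have hEf : MeasurableFibres fun x => if P x = Q x then none else some (P x) :=
      (hPf.prodMk hQf).comp fun ij : Fin k × Fin k => if ij.1 = ij.2 then none else some ij.1
    have hEsmall := hE (μ := muTilde m) hEf (by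
      convert hq using 3
      ext x; simp [hQ])
    -- Sliding a window of length `2 * N + 1` through `n` positions covers `n + 2 * N` places.
    have hword : ∀ n, partitionEntropy (muTilde m) (itinerary (dyckT m) Q n) ≤
        wordEntropy m (n + 2 * N) := by
      intro n
      rw [← partitionEntropy_wordAt (-N : ℤ)]
      refine partitionEntropy_le_of_factorsThrough
        (measurableFibres_of_measurable (measurable_wordAt _ _)) fun x y hxy => ?_
      rw [wordAt_eq_iff, blockList_eq_iff] at hxy
      funext j
      show q _ = q _
      congr 1
      refine blockList_eq_iff.2 fun l hl hl' => ?_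
      rw [iterate_dyckT_apply, iterate_dyckT_apply]
      have := j.2
      push_cast at hl'
      exact hxy _ (by omega) (by push_cast; omega)
    have hlim : Tendsto (fun n : ℕ => ((wordEntropy m (n + 2 * N) / n + ε : ℝ) : EReal)) atTop
        (nhds ((log 2 + 1 / 2 * log m + ε : ℝ) : EReal)) :=
      (continuous_coe_real_ereal.tendsto _).comp
        ((tendsto_wordEntropy_div m (2 * N)).add_const ε)
    rw [← hlim.limsup_eq]
    refine limsup_le_limsup ?_
    filter_upwards [eventually_gt_atTop 0] with n hn
    have hn' : (0 : ℝ) < n := by exact_mod_cast hn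
    rw [EReal.coe_le_coe_iff, div_add' _ _ _ hn'.ne']
    gcongr
    have h1 := partitionEntropy_itinerary_le_add (μ := muTilde m) hPf hQf
      measurePreserving_dyckT n
    have h2 := hword n
    have h3 := mul_le_mul_of_nonneg_left hEsmall.le hn'.le
    linarith
  by_contra hlt
  rw [not_le, EReal.lt_iff_exists_real_btwn] at hlt
  obtain ⟨b, hb1, hb2⟩ := hlt
  rw [EReal.coe_lt_coe_iff] at hb1
  have := key (b - (log 2 + 1 / 2 * log m)) (by linarith)
  rw [add_sub_cancel] at this
  exact absurd hb2 (not_lt.2 this)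

theorem ksEntropy_muTilde [NeZero m] :
    ksEntropy (muTilde m) (dyckT m) = ((log 2 + 1 / 2 * log m : ℝ) : EReal) := by
  refine le_antisymm (iSup_le fun k => iSup_le fun P => iSup_le fun hP =>
    entropyOfPartition_le hP) ?_
  -- The lower bound comes from the partition by the letter at `0`, whose itineraries are the words.
  set e := Fintype.equivFin (DyckLetter m) with he
  set P : dyckShift m → Fin (Fintype.card (DyckLetter m)) := fun x => e (x.1 0) with hP
  have hPm : Measurable P := (measurable_of_finite e).comp
    ((measurable_pi_apply 0).comp measurable_subtype_coe)
  refine le_trans ?_ (le_iSup_of_le _ (le_iSup_of_le P (le_iSup_of_le hPm le_rfl)))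
  have hlim : Tendsto (fun n : ℕ => ((wordEntropy m n / n : ℝ) : EReal)) atTop
      (nhds ((log 2 + 1 / 2 * log m : ℝ) : EReal)) :=
    (continuous_coe_real_ereal.tendsto _).comp (tendsto_wordEntropy_div m 0)
  rw [← hlim.limsup_eq]
  refine limsup_le_limsup (Eventually.of_forall fun n => ?_)
  rw [EReal.coe_le_coe_iff]
  gcongr
  rw [← partitionEntropy_wordAt 0]
  refine partitionEntropy_le_of_factorsThrough
    ((measurableFibres_of_measurable hPm).itinerary measurable_dyckT n) fun x y hxy => ?_
  funext j
  have := e.injective (congrFun hxy j)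
  rw [iterate_dyckT_apply, iterate_dyckT_apply] at this
  exact this

end KolmogorovSinai

/-! ### Topological entropy -/

section TopologicalEntropy

variable {m : ℕ} [NeZero m]

/-- The point of the Dyck shift with the brackets prescribed by `c` on `[0, n)`, where `none`
stands for a closing bracket, and opening brackets elsewhere. -/
noncomputable def prescribedSeq {n : ℕ} (c : Fin n → Option (Fin m)) : ℤ → DyckLetter m :=
  bracketSeq (fun k => if h : 0 ≤ k ∧ k.toNat < n then (c ⟨k.toNat, h.2⟩).isSome else true)
    (fun k => if h : 0 ≤ k ∧ k.toNat < n then (c ⟨k.toNat, h.2⟩).getD 0 else 0)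

theorem leftUnbounded_of_eventually_true {z : ℤ → Bool} (h : ∀ k < 0, z k = true) :
    LeftUnbounded z := by
  have key : ∀ n : ℕ, height z (-n) = -n := by
    intro n
    induction n with
    | zero => simp [height_zero]
    | succ n ih =>
      have := height_succ_of_true (h (-((n + 1 : ℕ) : ℤ)) (by push_cast; omega))
      rw [show -((n + 1 : ℕ) : ℤ) + 1 = -n by push_cast; ring, ih] at this
      push_cast at this ⊢; omega
  refine leftUnbounded_of_forall fun c => ⟨-((c + 1 : ℕ) : ℤ), by push_cast; omega, ?_⟩
  rw [key]; push_cast; omega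

theorem prescribedSeq_mem {n : ℕ} (c : Fin n → Option (Fin m)) :
    prescribedSeq c ∈ dyckShift m :=
  bracketSeq_mem_dyckShift (leftUnbounded_of_eventually_true fun k hk => by
    rw [dif_neg (by omega)]) _

theorem eq_of_prescribedSeq {n : ℕ} (c : Fin n → Option (Fin m)) (j : Fin n) :
    c j = if (prescribedSeq c (j : ℕ)).isOpening then some (prescribedSeq c (j : ℕ)).label
      else none := by
  have h : (0 : ℤ) ≤ (j : ℕ) ∧ ((j : ℕ) : ℤ).toNat < n := ⟨by omega, by simp⟩
  unfold prescribedSeq bracketSeq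
  cases hc : c j with
  | none => simp [hc, DyckLetter.isOpening]
  | some i => simp [hc, DyckLetter.isOpening, DyckLetter.label]

/-- The `(m + 1)ⁿ` points `prescribedSeq c` have different words on `[0, n)`; the opening brackets
on the negative side leave something for every closing bracket to match. Only this lower bound is
needed. -/
theorem log_le_coverEntropy :
    ENNReal.log (m + 1 : ℕ) ≤ Dynamics.coverEntropy (dyckT m) Set.univ := by
  classical
  set U : SetRel (dyckShift m) (dyckShift m) := {p | p.1.1 0 = p.2.1 0} with hU
  have hUm : U ∈ uniformity (dyckShift m) := by
    have h1 : UniformContinuous fun x : dyckShift m => x.1 0 :=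
      (Pi.uniformContinuous_proj _ 0).comp uniformContinuous_subtype_val
    have h2 : SetRel.id ∈ uniformity (DyckLetter m) := by
      rw [show uniformity (DyckLetter m) = Filter.principal SetRel.id from bot_uniformity]
      exact mem_principal_self _
    exact h1 h2
  refine le_trans ?_ (Dynamics.netEntropyEntourage_le_coverEntropy (F := Set.univ) (dyckT m) hUm)
  unfold Dynamics.netEntropyEntourage
  rw [← ExpGrowth.expGrowthSup_pow]
  refine ExpGrowth.expGrowthSup_monotone fun n => ?_
  set f : (Fin n → Option (Fin m)) → dyckShift m := fun c => ⟨prescribedSeq c, prescribedSeq_mem c⟩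
    with hf
  have hagree : ∀ c c', (∀ k < n, (f c).1 k = (f c').1 k) → c = c' := by
    intro c c' h
    funext j
    rw [eq_of_prescribedSeq c j, eq_of_prescribedSeq c' j]
    have : prescribedSeq c (j : ℕ) = prescribedSeq c' (j : ℕ) := h j j.2
    rw [this]
  have hinj : Function.Injective f := fun c c' h => hagree c c' fun k _ => by rw [h]
  have hnet : Dynamics.IsDynNetIn (dyckT m) Set.univ U n
      ((Finset.univ.image f : Finset (dyckShift m)) : Set (dyckShift m)) := by
    refine ⟨Set.subset_univ _, ?_⟩
    intro x hx y hy hne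
    simp only [Finset.coe_image, Finset.coe_univ, Set.image_univ, Set.mem_range] at hx hy
    obtain ⟨c, rfl⟩ := hx
    obtain ⟨c', rfl⟩ := hy
    refine Set.disjoint_left.2 fun v hv hv' => hne ?_
    rw [Dynamics.mem_ball_dynEntourage] at hv hv'
    congr 1
    -- A point `v` common to both dynamical balls shares its first `n` letters with both centres.
    refine hagree c c' fun k hk => ?_
    have h1 : ((dyckT m)^[k] (f c)).1 0 = ((dyckT m)^[k] v).1 0 := hv k hk
    have h2 : ((dyckT m)^[k] (f c')).1 0 = ((dyckT m)^[k] v).1 0 := hv' k hk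
    rw [← h2] at h1
    simpa [iterate_dyckT_apply] using h1
  have hcard := hnet.card_le_netMaxcard
  rw [Finset.card_image_of_injective _ hinj, Finset.card_univ, Fintype.card_fun,
    Fintype.card_option, Fintype.card_fin, Fintype.card_fin] at hcard
  have := ENat.toENNReal_mono hcard
  simpa using this

end TopologicalEntropy

/-- Doubled and exponentiated, this is `4m < (m + 1)²`, that is, `(m - 1)² > 0`. -/
theorem log_two_add_half_log_lt {m : ℕ} (hm : 2 ≤ m) :
    Real.log 2 + 1 / 2 * Real.log m < Real.log (m + 1) := by
  have hm' : (2 : ℝ) ≤ m := by exact_mod_cast hm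
  have h1 : Real.log (4 * m) < Real.log ((m + 1) ^ 2) :=
    Real.log_lt_log (by positivity) (by nlinarith)
  rw [Real.log_mul (by norm_num) (by positivity), Real.log_pow,
    show (4 : ℝ) = 2 ^ 2 by norm_num, Real.log_pow] at h1
  push_cast at h1
  linarith

theorem mainTheorem2 (m : ℕ) (hm : 2 ≤ m) :
    IsProbabilityMeasure (muTilde m) ∧
    MeasurePreserving (dyckT m) (muTilde m) (muTilde m) ∧
    DoubleTailInvariant (muTilde m) ∧
    ksEntropy (muTilde m) (dyckT m) = ((Real.log 2 + 1 / 2 * Real.log m : ℝ) : EReal) ∧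
    ksEntropy (muTilde m) (dyckT m) < Dynamics.coverEntropy (dyckT m) Set.univ ∧
    ¬ IsMaximalEntropyMeasure (muTilde m) (dyckT m) := by
  have : NeZero m := ⟨by omega⟩
  have hlt : ksEntropy (muTilde m) (dyckT m) < Dynamics.coverEntropy (dyckT m) Set.univ := by
    refine lt_of_lt_of_le ?_ log_le_coverEntropy
    rw [ksEntropy_muTilde, ENNReal.log_pos_real (by simp) (by simp), EReal.coe_lt_coe_iff]
    rw [ENNReal.toReal_natCast, Nat.cast_add_one]
    exact log_two_add_half_log_lt hm
  exact ⟨inferInstance, measurePreserving_dyckT, doubleTailInvariant_muTilde hm,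
    ksEntropy_muTilde, hlt, fun h => hlt.ne h.2.2⟩
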